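/- **Theorem (Kac–Rice formula for piecewise smooth processes in dimension $d\ge 2$).** Let $d\ge 2$ and let $\mathcal X\subset\mathbb R^d$ be an open connected set. Let $r:\mathcal X\to\mathbb R^d$ be a $\mathcal C^1$ vector field such that for every $\zeta\in\mathcal X$ the problem $x'(t)=r(x(t))$, $x(0)=\zeta$, has a (necessarily unique) solution $\phi(\zeta,\cdot):\mathbb R\to\mathcal X$ defined for all times. Let $(T_n,M_n)_{n\ge0}$ be a marked point process on $\mathbb R_+\times\mathcal X$, defined on a probability space, with $T_0=0<T_1\le T_2\le\dots$ and $T_n\to\infty$ almost surely, such that the expected number of jump times in any bounded interval is finite. Let $X$ be the piecewise smooth process given by $$X(t)=\phi(M_n,t-T_n)\qquad\text{for } T_n\le t<T_{n+1},\ n\ge 0,$$ and assume that, for every $t\ge0$, $X(t)$ has a density $p_{X(t)}$ with respect to Lebesgue measure on $\mathbb R^d$. Let $\mathcal D\subset\mathcal X$ be a bounded open connected set whose boundary $S=\partial\mathcal D$ in $\mathcal X$ is compact, and which has a $\mathcal C^1$ defining function: a $\mathcal C^1$ function $\rho:\mathbb R^d\to\mathbb R$ with $\mathcal D=\{x\in\mathcal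 X:\rho(x)<0\}$, $\mathcal X\setminus\overline{\mathcal D}=\{x\in\mathcal X:\rho(x)>0\}$ and $\nabla\rho\ne0$ on $S$. Let $\nu=\nabla\rho/\|\nabla\rho\|$ be the outward unit normal on $S$, and let $\sigma_{d-1}$ be the surface measure on $S$, that is, the $(d-1)$-dimensional Hausdorff measure, normalized so that it agrees with Lebesgue measure on $\mathbb R^{d-1}$. A path $z$ has a *continuous crossing* of $S$ at time $s>0$ if $z(s^-)=z(s)\in S$ and there is $\delta>0$ with $z(t)\notin S$ for all $t\in(s-\delta,s+\delta)\setminus\{s\}$. For $H\ge0$ let $c_S^z(H)\in\mathbb N\cup\{\infty\}$ be the number of continuous crossings of $S$ by $z$ within $[0,H]$. Fix a time horizon $H\ge0$ and assume: 1. $(r(x),\nu(x))\neq0$ for all $x\in S$, and $\sup_{x\in\mathcal X}c_S^{\phi(x,\cdot)}(H)<\infty$; 2. almost surely, $X$ does not jump from or to $S$: at every $t\in(0,H]$ with $X(t^-)\ne X(t)$, neither $X(t^-)$ nor $X(t)$ is in $S$; 3. for some neighborhood $\mathcal V_S$ of $S$, the map $(x,t)\mapsto p_{X(t)}(x)$ is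 continuous on $\mathcal V_S\times[0,H]$. Then $c_S^X(H)$ is (almost everywhere equal to) a random variable, the function $x\mapsto|(r(x),\nu(x))|\int_0^Hp_{X(s)}(x)\,ds$ is $\sigma_{d-1}$-integrable on $S$, and the expected number $C_S(H)=\mathbb E[c_S^X(H)]$ of continuous crossings of $S$ within $[0,H]$ is finite and satisfies $$C_S(H)=\int_S|(r(x),\nu(x))|\int_0^Hp_{X(s)}(x)\,ds\,\sigma_{d-1}(dx).$$ -/

import Mathlib

open Set Filter Topology MeasureTheory Gradient
open scoped ENNReal

namespace KacRice

noncomputable section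

variable {d : ℕ} {Ω : Type*}

/-- `φ ζ` is, for every `ζ ∈ U`, a solution on the whole of `ℝ` and inside `U` of the initial value
problem `x' = r x`, `x 0 = ζ`. When `r` is `C¹` on the open set `U`, this solution is unique (and
`C¹` in time), so that `φ` is determined on `U` and has the flow property there. -/
structure IsGlobalFlow (U : Set (EuclideanSpace ℝ (Fin d)))
    (r : EuclideanSpace ℝ (Fin d) → EuclideanSpace ℝ (Fin d))
    (φ : EuclideanSpace ℝ (Fin d) → ℝ → EuclideanSpace ℝ (Fin d)) : Prop where
  map_zero : ∀ ζ ∈ U, φ ζ 0 = ζ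
  mem : ∀ ζ ∈ U, ∀ t, φ ζ t ∈ U
  hasDerivAt : ∀ ζ ∈ U, ∀ t, HasDerivAt (φ ζ) (r (φ ζ t)) t

/-- `(T n, M n)` is a marked point process on `[0, ∞) × U` with `T 0 = 0 < T 1 ≤ T 2 ≤ …` and
`T n → ∞` almost surely. -/
structure IsMarkedPointProcess [MeasurableSpace Ω] (P : Measure Ω)
    (U : Set (EuclideanSpace ℝ (Fin d)))
    (T : ℕ → Ω → ℝ) (M : ℕ → Ω → EuclideanSpace ℝ (Fin d)) : Prop where
  measurable_time : ∀ n, Measurable (T n)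
  measurable_mark : ∀ n, Measurable (M n)
  mark_mem : ∀ n ω, M n ω ∈ U
  time_zero : ∀ᵐ ω ∂P, T 0 ω = 0
  time_one_pos : ∀ᵐ ω ∂P, 0 < T 1 ω
  time_mono : ∀ᵐ ω ∂P, ∀ n, T n ω ≤ T (n + 1) ω
  time_tendsto : ∀ᵐ ω ∂P, Tendsto (fun n => T n ω) atTop atTop

/-- The index of the last jump at or before time `t`. -/
def lastJump (T : ℕ → Ω → ℝ) (t : ℝ) (ω : Ω) : ℕ := sSup {n | T n ω ≤ t}

/-- The piecewise smooth process: `X t = φ (M n) (t - T n)` for `T n ≤ t < T (n + 1)`. -/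
def psp (φ : EuclideanSpace ℝ (Fin d) → ℝ → EuclideanSpace ℝ (Fin d))
    (T : ℕ → Ω → ℝ) (M : ℕ → Ω → EuclideanSpace ℝ (Fin d)) (t : ℝ) (ω : Ω) :
    EuclideanSpace ℝ (Fin d) :=
  φ (M (lastJump T t ω) ω) (t - T (lastJump T t ω) ω)

/-- The set of jump times in `[a, b]`. -/
def jumpTimes (T : ℕ → Ω → ℝ) (a b : ℝ) (ω : Ω) : Set ℝ :=
  {t | t ∈ Icc a b ∧ ∃ n, T n ω = t}

/-- `ρ` is a `C¹` defining function of `D` in `U`. -/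
structure IsDefiningFunction (U D : Set (EuclideanSpace ℝ (Fin d)))
    (ρ : EuclideanSpace ℝ (Fin d) → ℝ) : Prop where
  contDiff : ContDiff ℝ 1 ρ
  neg : D = {x ∈ U | ρ x < 0}
  pos : U \ closure D = {x ∈ U | 0 < ρ x}
  gradient_ne_zero : ∀ x ∈ U ∩ frontier D, ∇ ρ x ≠ 0

/-- The unit normal `∇ρ / ‖∇ρ‖`. -/
def unitNormal (ρ : EuclideanSpace ℝ (Fin d) → ℝ) (x : EuclideanSpace ℝ (Fin d)) :
    EuclideanSpace ℝ (Fin d) :=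
  ‖∇ ρ x‖⁻¹ • ∇ ρ x

/-- The path `z` has a continuous crossing of `S` at time `s`. -/
def IsContinuousCrossing (S : Set (EuclideanSpace ℝ (Fin d)))
    (z : ℝ → EuclideanSpace ℝ (Fin d)) (s : ℝ) : Prop :=
  0 < s ∧ Tendsto z (𝓝[<] s) (𝓝 (z s)) ∧ z s ∈ S ∧
    ∃ δ > 0, ∀ t ∈ Ioo (s - δ) (s + δ) \ {s}, z t ∉ S

/-- The number of continuous crossings of `S` by the path `z` within `[0, H]`. -/
def crossingCount (S : Set (EuclideanSpace ℝ (Fin d)))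
    (z : ℝ → EuclideanSpace ℝ (Fin d)) (H : ℝ) : ℕ∞ :=
  {s | s ∈ Icc 0 H ∧ IsContinuousCrossing S z s}.encard

/-- On `(0, H]`, the path `z` does not jump from `S` or to `S`: at a time `t` where its left limit
`y` differs from `z t`, neither `y` nor `z t` is in `S`. -/
def NoJumpFromOrTo (S : Set (EuclideanSpace ℝ (Fin d)))
    (z : ℝ → EuclideanSpace ℝ (Fin d)) (H : ℝ) : Prop :=
  ∀ t ∈ Ioc 0 H, ∀ y, Tendsto z (𝓝[<] t) (𝓝 y) → y ≠ z t → y ∉ S ∧ z t ∉ S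

/-- `f` is a probability density of `Y` with respect to Lebesgue measure. -/
structure IsDensityOf [MeasurableSpace Ω] (P : Measure Ω)
    (Y : Ω → EuclideanSpace ℝ (Fin d)) (f : EuclideanSpace ℝ (Fin d) → ℝ) : Prop where
  measurable : Measurable f
  nonneg : ∀ x, 0 ≤ f x
  map_eq : P.map Y = volume.withDensity (fun x => ENNReal.ofReal (f x))

end

end KacRice

/-!
Write `X` for the process, `ρ` for the defining function and `g x = ⟪∇ρ x, r x⟫` for the speed at
which `ρ` changes along the flow. The number of crossings is the limit, as `δ → 0`, of the
approximate counting integrals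
`A_δ = ∫_0^H (2δ)⁻¹ 1_{|ρ (X s)| < δ} f (X s) |g (X s)| ds`,
where `f` is a cutoff function that equals `1` on `S` and is supported where the flow is transverse
to the level sets of `ρ`. Taking expectations turns `A_δ` into an integral over a thin layer around
`S`, and the layer integrals converge to a surface integral. This takes four ingredients.

* Pathwise limit (`IsGoodPath.tendsto_crossingCount`). On each smooth piece, `s ↦ ρ (X s)` has only
  simple zeros, with derivative `g (X s)`, so that every zero contributes `1` to the limit, or `1/2`
  if it is an endpoint of the piece. As the path does not jump from or to `S`, a zero at a jump time
  is an endpoint of two pieces, and the halves add up. At the times `0` and `H` the path is almost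
  surely off `S`, a Lebesgue null set.

* Domination (`IsGoodPath.lintegral_path_le`). By compactness the flow stays transverse for a uniform
  time after and before any visit to the support of `f`. Hence, for small `δ`, times with
  `|ρ (X s)| < δ` that count lie within `O(δ)` of a zero or of an endpoint of the smooth piece. As the
  number of zeros on a piece is bounded, `A_δ` is at most a constant times the number of jump times,
  which is integrable.

* Expectation (`lintegral_lintegral_psp`, `lintegral_lintegral_density`). By Tonelli,
  `𝔼 A_δ = ∫ (2δ)⁻¹ 1_{|ρ x| < δ} f x |g x| ∫_0^H p_s x ds dx`.

* Layers (`exists_cutoff_tendsto_lintegral_levelKernel`). Near a point of `S`, the function `ρ` is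
  linear up to a small relative error. Integration along the lines in the direction of its gradient
  reduces the layer integral to the one-dimensional limit, and the projection of the level set to
  the orthogonal hyperplane is bi-Lipschitz with constants close to `1`, so that it almost preserves
  the Hausdorff measure. This gives the surface integral of `f |g| ∫ p / ‖∇ρ‖` up to a factor `c`,
  where `c > 1` is as close to `1` as desired. A partition of unity, which also provides `f`, passes
  from small balls to `S`.

The cutoff depends on `c`, but the expected number of crossings and the surface integral do not, so
that `c → 1` gives their equality.
-/

namespace KacRice

/-! ### Approximate counting of a simple zero -/

/-- The approximate Dirac mass at level `0`: the weight `k` is counted with factor `1 / (2δ)` where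
the value `v` is smaller than `δ` in absolute value. -/
noncomputable def levelKernel (δ v k : ℝ) : ℝ≥0∞ :=
  ENNReal.ofReal (if |v| < δ then (2 * δ)⁻¹ * k else 0)

theorem levelKernel_of_lt {δ v k : ℝ} (h : |v| < δ) :
    levelKernel δ v k = ENNReal.ofReal ((2 * δ)⁻¹ * k) := by
  simp [levelKernel, h]

theorem levelKernel_of_le {δ v k : ℝ} (h : δ ≤ |v|) : levelKernel δ v k = 0 := by
  simp [levelKernel, not_lt.2 h]

@[simp]
theorem levelKernel_zero_right (δ v : ℝ) : levelKernel δ v 0 = 0 := by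
  simp [levelKernel]

theorem levelKernel_le {δ v k C : ℝ} (hδ : 0 < δ) (hk : k ≤ C) :
    levelKernel δ v k ≤ ENNReal.ofReal ((2 * δ)⁻¹ * C) := by
  rcases lt_or_ge (|v|) δ with h | h
  · rw [levelKernel_of_lt h]
    gcongr
  · simp [levelKernel_of_le h]

theorem measurable_levelKernel {α : Type*} [MeasurableSpace α] {f k : α → ℝ}
    (hf : Measurable f) (hk : Measurable k) (δ : ℝ) :
    Measurable fun x => levelKernel δ (f x) (k x) := by
  unfold levelKernel
  refine ENNReal.measurable_ofReal.comp (Measurable.ite ?_ (hk.const_mul _) measurable_const)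
  exact measurableSet_lt hf.abs measurable_const

theorem lintegral_Ioi_zero_comp_mul {δ : ℝ} (hδ : 0 < δ) {Φ : ℝ → ℝ≥0∞} (hΦ : Measurable Φ) :
    ∫⁻ s in Ioi (0 : ℝ), Φ s = ∫⁻ u in Ioi (0 : ℝ), ENNReal.ofReal δ * Φ (δ * u) := by
  have h1 : ∫⁻ u in Ioi (0 : ℝ), Φ (δ * u) = ENNReal.ofReal |δ⁻¹| * ∫⁻ s in Ioi (0 : ℝ), Φ s := by
    rw [← lintegral_indicator measurableSet_Ioi, ← lintegral_indicator measurableSet_Ioi,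
      ← smul_eq_mul, ← lintegral_smul_measure, ← Real.map_volume_mul_left hδ.ne',
      lintegral_map (hΦ.indicator measurableSet_Ioi) (measurable_const_mul δ)]
    refine lintegral_congr fun u => ?_
    simp only [indicator, mem_Ioi, mul_pos_iff_of_pos_left hδ]
  rw [lintegral_const_mul _ (by fun_prop), h1, ← mul_assoc, ← ENNReal.ofReal_mul hδ.le,
    abs_of_pos (by positivity), mul_inv_cancel₀ hδ.ne', ENNReal.ofReal_one, one_mul]

theorem ofReal_mul_levelKernel {δ v k : ℝ} (hδ : 0 < δ) :
    ENNReal.ofReal δ * levelKernel δ v k = ENNReal.ofReal (if |v| < δ then k / 2 else 0) := by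
  rw [levelKernel, ← ENNReal.ofReal_mul hδ.le]
  congr 1
  split_ifs
  · field_simp
  · simp

/-- After the change of variables `s = δ u`, the approximate counting integral to the right of a
simple zero converges by dominated convergence. -/
theorem tendsto_lintegral_levelKernel_Ioi_zero {f k : ℝ → ℝ} {m k₀ c C : ℝ} (hf : Measurable f)
    (hk : Measurable k) (hf0 : f 0 = 0) (hfm : HasDerivWithinAt f m (Ioi 0) 0) (hm : m ≠ 0)
    (hk0 : Tendsto k (𝓝[>] 0) (𝓝 k₀)) (hkC : ∀ s, k s ≤ C) (hc : 0 < c)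
    (hfc : ∀ s, 0 < s → k s ≠ 0 → c * s ≤ |f s|) :
    Tendsto (fun δ => ∫⁻ s in Ioi (0 : ℝ), levelKernel δ (f s) (k s)) (𝓝[>] 0)
      (𝓝 (ENNReal.ofReal (k₀ / (2 * |m|)))) := by
  have hm' : 0 < |m| := abs_pos.2 hm
  have key : Tendsto (fun δ => ∫⁻ u in Ioi (0 : ℝ),
      ENNReal.ofReal (if |f (δ * u)| < δ then k (δ * u) / 2 else 0)) (𝓝[>] 0)
      (𝓝 (∫⁻ u in Ioi (0 : ℝ), (Iio (|m|⁻¹)).indicator (fun _ => ENNReal.ofReal (k₀ / 2)) u)) := by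
    -- the growth of `f` confines the integrand to `u ≤ c⁻¹`, uniformly in `δ`
    refine tendsto_lintegral_filter_of_dominated_convergence
      ((Iic (c⁻¹)).indicator fun _ => ENNReal.ofReal (C / 2)) ?_ ?_ ?_ ?_
    · refine Eventually.of_forall fun δ => ENNReal.measurable_ofReal.comp (Measurable.ite ?_ ?_ ?_)
      · exact measurableSet_lt (hf.comp (measurable_const_mul δ)).abs measurable_const
      · exact (hk.comp (measurable_const_mul δ)).div_const _
      · exact measurable_const
    · filter_upwards [self_mem_nhdsWithin] with δ hδ
      have hδ : 0 < δ := hδ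
      filter_upwards [ae_restrict_mem measurableSet_Ioi] with u hu
      have hu : 0 < u := hu
      by_cases hku : k (δ * u) = 0
      · simp [hku]
      split_ifs with hlt
      · have h1 := (hfc (δ * u) (by positivity) hku).trans_lt hlt
        have h2 : u ≤ c⁻¹ := by
          rw [le_inv_comm₀ hu hc, inv_eq_one_div, le_div_iff₀ hu]
          by_contra! h
          nlinarith
        rw [indicator_of_mem (by exact h2)]
        exact ENNReal.ofReal_le_ofReal (by linarith [hkC (δ * u)])
      · simp
    · rw [lintegral_indicator measurableSet_Iic, Measure.restrict_restrict measurableSet_Iic,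
        setLIntegral_const]
      refine ENNReal.mul_ne_top ENNReal.ofReal_ne_top ?_
      rw [inter_comm, Ioi_inter_Iic, Real.volume_Ioc]
      exact ENNReal.ofReal_ne_top
    -- `|f (δ u)| < δ` amounts to `|m| u < 1` in the limit, except on the boundary `u = |m|⁻¹`
    · have hne : ∀ᵐ u ∂(volume.restrict (Ioi (0 : ℝ))), u ≠ |m|⁻¹ :=
        ae_restrict_of_ae (Measure.ae_ne volume _)
      filter_upwards [ae_restrict_mem measurableSet_Ioi, hne] with u hu hum
      have hu : 0 < u := hu
      have hlim : Tendsto (fun δ : ℝ => δ * u) (𝓝[>] 0) (𝓝[>] 0) := by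
        refine tendsto_nhdsWithin_iff.2 ⟨?_, ?_⟩
        · have : Tendsto (fun δ : ℝ => δ * u) (𝓝 0) (𝓝 (0 * u)) :=
            tendsto_id.mul_const u
          rw [zero_mul] at this
          exact this.mono_left nhdsWithin_le_nhds
        · filter_upwards [self_mem_nhdsWithin] with δ hδ
          exact mul_pos hδ hu
      have hslope : Tendsto (fun δ : ℝ => |f (δ * u)| / δ) (𝓝[>] 0) (𝓝 (|m| * u)) := by
        have h1 := ((hasDerivWithinAt_iff_tendsto_slope' (by simp)).1 hfm).comp hlim
        have h2 := h1.abs.mul_const u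
        refine h2.congr' ?_
        filter_upwards [self_mem_nhdsWithin] with δ hδ
        have hδ : 0 < δ := hδ
        simp only [Function.comp, slope_def_field, hf0, sub_zero, abs_div, abs_mul,
          abs_of_pos hδ, abs_of_pos hu]
        field_simp
      rcases lt_or_gt_of_ne hum with h | h
      · rw [indicator_of_mem (by exact h)]
        have h1 : |m| * u < 1 := by
          rwa [lt_inv_comm₀ hu hm', inv_eq_one_div, lt_div_iff₀ hu] at h
        refine (ENNReal.tendsto_ofReal ((hk0.comp hlim).div_const 2)).congr' ?_
        filter_upwards [self_mem_nhdsWithin, hslope.eventually_lt_const h1] with δ hδ hδ1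
        rw [div_lt_one hδ] at hδ1
        simp [hδ1]
      · rw [indicator_of_notMem (by simpa using h.le)]
        have h1 : 1 < |m| * u := by
          rwa [inv_eq_one_div, div_lt_iff₀' hm'] at h
        refine tendsto_const_nhds.congr' ?_
        filter_upwards [self_mem_nhdsWithin, hslope.eventually_const_lt h1] with δ hδ hδ1
        rw [one_lt_div hδ] at hδ1
        simp [hδ1.not_gt]
  have hval : ∫⁻ u in Ioi (0 : ℝ), (Iio (|m|⁻¹)).indicator (fun _ => ENNReal.ofReal (k₀ / 2)) u =
      ENNReal.ofReal (k₀ / (2 * |m|)) := by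
    rw [lintegral_indicator measurableSet_Iio, Measure.restrict_restrict measurableSet_Iio,
      setLIntegral_const, inter_comm, Ioi_inter_Iio, Real.volume_Ioo, sub_zero,
      ← ENNReal.ofReal_mul' (by positivity)]
    congr 1
    field_simp
  rw [hval] at key
  refine key.congr' ?_
  filter_upwards [self_mem_nhdsWithin] with δ hδ
  rw [lintegral_Ioi_zero_comp_mul hδ (measurable_levelKernel hf hk δ)]
  exact lintegral_congr fun u => (ofReal_mul_levelKernel hδ).symm

theorem setLIntegral_Ioi_eq_comp_add (t : ℝ) (Φ : ℝ → ℝ≥0∞) :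
    ∫⁻ s in Ioi t, Φ s = ∫⁻ s in Ioi (0 : ℝ), Φ (t + s) := by
  rw [← lintegral_indicator measurableSet_Ioi, ← lintegral_indicator measurableSet_Ioi,
    ← lintegral_add_left_eq_self _ t]
  refine lintegral_congr fun u => ?_
  simp [indicator]

theorem setLIntegral_Iio_eq_comp_sub (t : ℝ) (Φ : ℝ → ℝ≥0∞) :
    ∫⁻ s in Iio t, Φ s = ∫⁻ s in Ioi (0 : ℝ), Φ (t - s) := by
  rw [← lintegral_indicator measurableSet_Ioi, ← lintegral_indicator measurableSet_Iio,
    ← lintegral_sub_left_eq_self _ t]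
  refine lintegral_congr fun u => ?_
  simp [indicator]

theorem tendsto_lintegral_levelKernel_Ioi {f k : ℝ → ℝ} {t m k₀ c C : ℝ} (hf : Measurable f)
    (hk : Measurable k) (hf0 : f t = 0) (hfm : HasDerivAt f m t) (hm : m ≠ 0)
    (hk0 : Tendsto k (𝓝[>] t) (𝓝 k₀)) (hkC : ∀ s, k s ≤ C) (hc : 0 < c)
    (hfc : ∀ s, t < s → k s ≠ 0 → c * (s - t) ≤ |f s|) :
    Tendsto (fun δ => ∫⁻ s in Ioi t, levelKernel δ (f s) (k s)) (𝓝[>] 0)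
      (𝓝 (ENNReal.ofReal (k₀ / (2 * |m|)))) := by
  simp_rw [setLIntegral_Ioi_eq_comp_add t]
  have hlim : Tendsto (fun s : ℝ => t + s) (𝓝[>] 0) (𝓝[>] t) := by
    refine tendsto_nhdsWithin_iff.2 ⟨?_, ?_⟩
    · have : Tendsto (fun s : ℝ => t + s) (𝓝 0) (𝓝 (t + 0)) := tendsto_id.const_add t
      rw [add_zero] at this
      exact this.mono_left nhdsWithin_le_nhds
    · filter_upwards [self_mem_nhdsWithin] with s hs
      simpa using hs
  refine tendsto_lintegral_levelKernel_Ioi_zero (f := fun s => f (t + s))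
    (k := fun s => k (t + s)) (C := C) (hf.comp (measurable_const_add t))
    (hk.comp (measurable_const_add t)) (by simpa using hf0) ?_ hm (hk0.comp hlim)
    (fun s => hkC _) hc fun s hs hks => ?_
  · refine HasDerivAt.hasDerivWithinAt ?_
    have := HasDerivAt.comp_const_add t 0 (f := f) (f' := m) (by simpa using hfm)
    exact this
  · simpa using hfc (t + s) (by linarith) hks

theorem tendsto_lintegral_levelKernel_Iio {f k : ℝ → ℝ} {t m k₀ c C : ℝ} (hf : Measurable f)
    (hk : Measurable k) (hf0 : f t = 0) (hfm : HasDerivAt f m t) (hm : m ≠ 0)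
    (hk0 : Tendsto k (𝓝[<] t) (𝓝 k₀)) (hkC : ∀ s, k s ≤ C) (hc : 0 < c)
    (hfc : ∀ s, s < t → k s ≠ 0 → c * (t - s) ≤ |f s|) :
    Tendsto (fun δ => ∫⁻ s in Iio t, levelKernel δ (f s) (k s)) (𝓝[>] 0)
      (𝓝 (ENNReal.ofReal (k₀ / (2 * |m|)))) := by
  simp_rw [setLIntegral_Iio_eq_comp_sub t]
  have hlim : Tendsto (fun s : ℝ => t - s) (𝓝[>] 0) (𝓝[<] t) := by
    refine tendsto_nhdsWithin_iff.2 ⟨?_, ?_⟩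
    · have : Tendsto (fun s : ℝ => t - s) (𝓝 0) (𝓝 (t - 0)) := tendsto_id.const_sub t
      rw [sub_zero] at this
      exact this.mono_left nhdsWithin_le_nhds
    · filter_upwards [self_mem_nhdsWithin] with s hs
      simpa using hs
  rw [← abs_neg m]
  refine tendsto_lintegral_levelKernel_Ioi_zero (f := fun s => f (t - s))
    (k := fun s => k (t - s)) (C := C) (hf.comp (measurable_const_sub t))
    (hk.comp (measurable_const_sub t)) (by simpa using hf0) ?_ (neg_ne_zero.2 hm) (hk0.comp hlim)
    (fun s => hkC _) hc fun s hs hks => ?_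
  · refine HasDerivAt.hasDerivWithinAt ?_
    have := HasDerivAt.comp_const_sub t 0 (f := f) (f' := m) (by simpa using hfm)
    exact this
  · simpa using hfc (t - s) (by linarith) hks

/-- The contribution of a single simple zero on the line: the approximate counting integral tends
to the weight at the zero divided by the absolute value of the derivative. -/
theorem tendsto_lintegral_levelKernel_of_unique_zero {f k : ℝ → ℝ} {t m c C : ℝ}
    (hf : Measurable f) (hk : Continuous k) (hf0 : f t = 0) (hfm : HasDerivAt f m t) (hm : m ≠ 0)
    (hk0 : 0 ≤ k t) (hkC : ∀ s, k s ≤ C) (hc : 0 < c)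
    (hfc : ∀ s, k s ≠ 0 → c * |s - t| ≤ |f s|) :
    Tendsto (fun δ => ∫⁻ s, levelKernel δ (f s) (k s)) (𝓝[>] 0)
      (𝓝 (ENNReal.ofReal (k t / |m|))) := by
  have h1 := tendsto_lintegral_levelKernel_Ioi hf hk.measurable hf0 hfm hm
    (hk.continuousAt.mono_left nhdsWithin_le_nhds) hkC hc fun s hs hks => by
      simpa [abs_of_pos (sub_pos.2 hs)] using hfc s hks
  have h2 := tendsto_lintegral_levelKernel_Iio hf hk.measurable hf0 hfm hm
    (hk.continuousAt.mono_left nhdsWithin_le_nhds) hkC hc fun s hs hks => by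
      simpa [abs_sub_comm s t, abs_of_pos (sub_pos.2 hs)] using hfc s hks
  have h3 := h2.add h1
  rw [← ENNReal.ofReal_add (by positivity) (by positivity)] at h3
  have e : k t / (2 * |m|) + k t / (2 * |m|) = k t / |m| := by
    have := abs_pos.2 hm
    field_simp
    norm_num
  rw [e] at h3
  refine h3.congr fun δ => ?_
  rw [setLIntegral_congr Ioi_ae_eq_Ici, ← compl_Iio, lintegral_add_compl _ measurableSet_Iio]

/-! ### Counting zeros on an interval -/

/-- The number of points of `Z` in `[a, b]`, where the endpoints count for one half. With this
convention the number is additive over adjacent intervals. -/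
noncomputable def halfCount (Z : Set ℝ) (a b : ℝ) : ℝ≥0∞ :=
  2⁻¹ * (((Z ∩ Ico a b).encard : ℝ≥0∞) + ((Z ∩ Ioc a b).encard : ℝ≥0∞))

theorem halfCount_add (Z : Set ℝ) {a b c : ℝ} (hab : a ≤ b) (hbc : b ≤ c) :
    halfCount Z a b + halfCount Z b c = halfCount Z a c := by
  have h1 : (Z ∩ Ico a c).encard = (Z ∩ Ico a b).encard + (Z ∩ Ico b c).encard := by
    rw [← Ico_union_Ico_eq_Ico hab hbc, inter_union_distrib_left, encard_union_eq]
    exact (Ico_disjoint_Ico_same).mono inter_subset_right inter_subset_right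
  have h2 : (Z ∩ Ioc a c).encard = (Z ∩ Ioc a b).encard + (Z ∩ Ioc b c).encard := by
    rw [← Ioc_union_Ioc_eq_Ioc hab hbc, inter_union_distrib_left, encard_union_eq]
    exact (Ioc_disjoint_Ioc_of_le le_rfl).mono inter_subset_right inter_subset_right
  simp only [halfCount, h1, h2, ENat.toENNReal_add]
  ring

theorem halfCount_of_disjoint {Z : Set ℝ} {a b : ℝ} (h : ∀ t ∈ Icc a b, t ∉ Z) :
    halfCount Z a b = 0 := by
  have h1 : Z ∩ Ico a b = ∅ :=
    eq_empty_iff_forall_notMem.2 fun t ⟨ht, h1, h2⟩ => h t ⟨h1, h2.le⟩ ht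
  have h2 : Z ∩ Ioc a b = ∅ :=
    eq_empty_iff_forall_notMem.2 fun t ⟨ht, h1, h2⟩ => h t ⟨h1.le, h2⟩ ht
  simp [halfCount, h1, h2]

theorem halfCount_self (Z : Set ℝ) (a : ℝ) : halfCount Z a a = 0 := by
  simp [halfCount]

theorem halfCount_of_left {Z : Set ℝ} {a b : ℝ} (hab : a < b) (ha : a ∈ Z)
    (h : ∀ t ∈ Ioc a b, t ∉ Z) : halfCount Z a b = 2⁻¹ := by
  have h1 : Z ∩ Ico a b = {a} := by
    ext t
    simp only [mem_inter_iff, mem_Ico, mem_singleton_iff]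
    refine ⟨fun ⟨ht, h1, h2⟩ => ?_, fun ht => by simp [ht, ha, hab]⟩
    rcases h1.eq_or_lt with h1 | h1
    · exact h1.symm
    · exact absurd ht (h t ⟨h1, h2.le⟩)
  have h2 : Z ∩ Ioc a b = ∅ :=
    eq_empty_iff_forall_notMem.2 fun t ⟨ht, h1, h2⟩ => h t ⟨h1, h2⟩ ht
  simp [halfCount, h1, h2]

theorem halfCount_of_right {Z : Set ℝ} {a b : ℝ} (hab : a < b) (hb : b ∈ Z)
    (h : ∀ t ∈ Ico a b, t ∉ Z) : halfCount Z a b = 2⁻¹ := by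
  have h1 : Z ∩ Ioc a b = {b} := by
    ext t
    simp only [mem_inter_iff, mem_Ioc, mem_singleton_iff]
    refine ⟨fun ⟨ht, h1, h2⟩ => ?_, fun ht => by simp [ht, hb, hab]⟩
    rcases h2.eq_or_lt with h2 | h2
    · exact h2
    · exact absurd ht (h t ⟨h1.le, h2⟩)
  have h2 : Z ∩ Ico a b = ∅ :=
    eq_empty_iff_forall_notMem.2 fun t ⟨ht, h1, h2⟩ => h t ⟨h1, h2⟩ ht
  simp [halfCount, h1, h2]

/-- The approximate counting integrals of the zeros of `f` on `[a, b]` converge to the number of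
zeros, endpoints counting for one half. -/
def ApproximatesHalfCount (f k : ℝ → ℝ) (a b : ℝ) : Prop :=
  Tendsto (fun δ => ∫⁻ s in Ioc a b, levelKernel δ (f s) (k s)) (𝓝[>] 0)
    (𝓝 (halfCount {t | f t = 0} a b))

theorem ApproximatesHalfCount.trans {f k : ℝ → ℝ} {a b c : ℝ}
    (h1 : ApproximatesHalfCount f k a b) (h2 : ApproximatesHalfCount f k b c)
    (hab : a ≤ b) (hbc : b ≤ c) : ApproximatesHalfCount f k a c := by
  have h := Tendsto.add h1 h2
  rw [halfCount_add _ hab hbc] at h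
  refine h.congr fun δ => ?_
  rw [← lintegral_union measurableSet_Ioc (Ioc_disjoint_Ioc_of_le le_rfl),
    Ioc_union_Ioc_eq_Ioc hab hbc]

theorem approximatesHalfCount_self (f k : ℝ → ℝ) (a : ℝ) : ApproximatesHalfCount f k a a := by
  simp [ApproximatesHalfCount, halfCount_self]

theorem approximatesHalfCount_of_ne_zero {f k : ℝ → ℝ} {a b : ℝ} (hf : ContinuousOn f (Icc a b))
    (h : ∀ t ∈ Icc a b, f t ≠ 0) : ApproximatesHalfCount f k a b := by
  rw [ApproximatesHalfCount, halfCount_of_disjoint (by simpa using h)]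
  rcases lt_or_ge b a with hab | hab
  · simp [Ioc_eq_empty hab.not_gt]
  obtain ⟨t, ht, hmin⟩ := isCompact_Icc.exists_isMinOn (nonempty_Icc.2 hab) hf.abs
  refine tendsto_const_nhds.congr' ?_
  filter_upwards [Ioo_mem_nhdsGT (abs_pos.2 (h t ht))] with δ hδ
  refine (setLIntegral_eq_zero measurableSet_Ioc fun s hs => ?_).symm
  exact levelKernel_of_le (hδ.2.le.trans (hmin (Ioc_subset_Icc_self hs)))

theorem eventually_mul_abs_sub_le_of_hasDerivAt {f : ℝ → ℝ} {m t : ℝ} (hfm : HasDerivAt f m t)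
    (hm : m ≠ 0) (hf0 : f t = 0) : ∀ᶠ s in 𝓝 t, |m| / 2 * |s - t| ≤ |f s| := by
  have h := (hasDerivAt_iff_isLittleO.1 hfm).def (half_pos (abs_pos.2 hm))
  filter_upwards [h] with s hs
  simp only [hf0, sub_zero, smul_eq_mul, Real.norm_eq_abs] at hs
  have h1 : |(s - t) * m| - |f s| ≤ |f s - (s - t) * m| := by
    rw [abs_sub_comm]
    exact abs_sub_abs_le_abs_sub _ _
  rw [abs_mul] at h1
  nlinarith

/-- A simple zero at the left endpoint contributes one half. -/
theorem approximatesHalfCount_right {f k : ℝ → ℝ} {t v m : ℝ} (hf : Continuous f)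
    (hk : Continuous k) (hf0 : f t = 0) (hfm : HasDerivAt f m t) (hm : m ≠ 0) (hkt : k t = |m|)
    (htv : t ≤ v) (hfc : ∀ s ∈ Icc t v, |m| / 2 * |s - t| ≤ |f s|) :
    ApproximatesHalfCount f k t v := by
  rcases htv.eq_or_lt with rfl | htv
  · exact approximatesHalfCount_self _ _ _
  have hm' := abs_pos.2 hm
  obtain ⟨C, hC⟩ := (isCompact_Icc (a := t) (b := v)).exists_bound_of_continuousOn hk.continuousOn
  have hC0 : 0 ≤ C := (norm_nonneg _).trans (hC t ⟨le_rfl, htv.le⟩)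
  have key := tendsto_lintegral_levelKernel_Ioi (k := (Ioc t v).indicator k) (k₀ := |m|) (C := C)
    hf.measurable (hk.measurable.indicator measurableSet_Ioc) hf0 hfm hm ?_ ?_ (half_pos hm') ?_
  · rw [ApproximatesHalfCount, halfCount_of_left htv hf0]
    · have e : ENNReal.ofReal (|m| / (2 * |m|)) = 2⁻¹ := by
        rw [show |m| / (2 * |m|) = 2⁻¹ by field_simp, ENNReal.ofReal_inv_of_pos two_pos]
        simp
      rw [e] at key
      refine key.congr fun δ => ?_
      rw [← lintegral_indicator measurableSet_Ioi, ← lintegral_indicator measurableSet_Ioc]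
      refine lintegral_congr fun s => ?_
      by_cases h1 : s ∈ Ioc t v
      · simp [h1, h1.1]
      · simp [h1]
    · intro s hs hs0
      have h1 := hfc s (Ioc_subset_Icc_self hs)
      have hs0 : f s = 0 := hs0
      rw [hs0, abs_zero, abs_of_pos (sub_pos.2 hs.1)] at h1
      nlinarith [mul_pos hm' (sub_pos.2 hs.1)]
  · rw [← hkt]
    refine (hk.continuousAt.mono_left nhdsWithin_le_nhds).congr' ?_
    filter_upwards [Ioc_mem_nhdsGT htv] with s hs
    simp [hs]
  · intro s
    by_cases h1 : s ∈ Ioc t v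
    · rw [indicator_of_mem h1]
      exact (le_abs_self _).trans (hC s (Ioc_subset_Icc_self h1))
    · simpa [h1] using hC0
  · intro s hs hks
    have h1 : s ∈ Ioc t v := by
      by_contra h1
      simp [h1] at hks
    simpa [abs_of_pos (sub_pos.2 hs)] using hfc s (Ioc_subset_Icc_self h1)

/-- A simple zero at the right endpoint contributes one half. -/
theorem approximatesHalfCount_left {f k : ℝ → ℝ} {t u m : ℝ} (hf : Continuous f)
    (hk : Continuous k) (hf0 : f t = 0) (hfm : HasDerivAt f m t) (hm : m ≠ 0) (hkt : k t = |m|)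
    (hut : u ≤ t) (hfc : ∀ s ∈ Icc u t, |m| / 2 * |s - t| ≤ |f s|) :
    ApproximatesHalfCount f k u t := by
  rcases hut.eq_or_lt with rfl | hut
  · exact approximatesHalfCount_self _ _ _
  have hm' := abs_pos.2 hm
  obtain ⟨C, hC⟩ := (isCompact_Icc (a := u) (b := t)).exists_bound_of_continuousOn hk.continuousOn
  have hC0 : 0 ≤ C := (norm_nonneg _).trans (hC t ⟨hut.le, le_rfl⟩)
  have key := tendsto_lintegral_levelKernel_Iio (k := (Ioo u t).indicator k) (k₀ := |m|) (C := C)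
    hf.measurable (hk.measurable.indicator measurableSet_Ioo) hf0 hfm hm ?_ ?_ (half_pos hm') ?_
  · rw [ApproximatesHalfCount, halfCount_of_right hut hf0]
    · have e : ENNReal.ofReal (|m| / (2 * |m|)) = 2⁻¹ := by
        rw [show |m| / (2 * |m|) = 2⁻¹ by field_simp, ENNReal.ofReal_inv_of_pos two_pos]
        simp
      rw [e] at key
      refine key.congr fun δ => ?_
      rw [← setLIntegral_congr Ioo_ae_eq_Ioc, ← lintegral_indicator measurableSet_Iio,
        ← lintegral_indicator measurableSet_Ioo]
      refine lintegral_congr fun s => ?_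
      by_cases h1 : s ∈ Ioo u t
      · simp [h1, h1.2]
      · simp [h1]
    · intro s hs hs0
      have h1 := hfc s (Ico_subset_Icc_self hs)
      have hs0 : f s = 0 := hs0
      rw [hs0, abs_zero, abs_of_neg (sub_neg.2 hs.2)] at h1
      nlinarith [mul_pos hm' (sub_pos.2 hs.2)]
  · rw [← hkt]
    refine (hk.continuousAt.mono_left nhdsWithin_le_nhds).congr' ?_
    filter_upwards [Ioo_mem_nhdsLT hut] with s hs
    simp [hs]
  · intro s
    by_cases h1 : s ∈ Ioo u t
    · rw [indicator_of_mem h1]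
      exact (le_abs_self _).trans (hC s (Ioo_subset_Icc_self h1))
    · simpa [h1] using hC0
  · intro s hs hks
    have h1 : s ∈ Ioo u t := by
      by_contra h1
      simp [h1] at hks
    simpa [abs_sub_comm s t, abs_of_pos (sub_pos.2 hs)] using hfc s (Ioo_subset_Icc_self h1)

/-- The local form of the convergence: a simple zero is isolated, so that short intervals near it
contain at most this zero. -/
theorem exists_forall_approximatesHalfCount {f k : ℝ → ℝ} (hf : Continuous f) (hk : Continuous k)
    {t : ℝ} (hz : f t = 0 → ∃ m, m ≠ 0 ∧ HasDerivAt f m t ∧ k t = |m|) :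
    ∃ ε > 0, ∀ u v, u ≤ v → |u - t| < ε → |v - t| < ε → ApproximatesHalfCount f k u v := by
  by_cases hft : f t = 0
  · obtain ⟨m, hm, hfm, hkt⟩ := hz hft
    have hm' := abs_pos.2 hm
    obtain ⟨ε, hε, h⟩ := Metric.eventually_nhds_iff.1
      (eventually_mul_abs_sub_le_of_hasDerivAt hfm hm hft)
    simp only [Real.dist_eq] at h
    refine ⟨ε, hε, fun u v huv hu hv => ?_⟩
    have hin : ∀ s ∈ Icc u v, |m| / 2 * |s - t| ≤ |f s| := by
      intro s hs
      rw [abs_lt] at hu hv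
      exact h (abs_lt.2 ⟨by linarith [hs.1], by linarith [hs.2]⟩)
    by_cases htuv : t ∈ Icc u v
    · exact (approximatesHalfCount_left hf hk hft hfm hm hkt htuv.1
        fun s hs => hin s ⟨hs.1, hs.2.trans htuv.2⟩).trans
        (approximatesHalfCount_right hf hk hft hfm hm hkt htuv.2
        fun s hs => hin s ⟨htuv.1.trans hs.1, hs.2⟩) htuv.1 htuv.2
    · refine approximatesHalfCount_of_ne_zero hf.continuousOn fun s hs hs0 => ?_
      have h1 := hin s hs
      have h2 : 0 < |s - t| := abs_pos.2 (sub_ne_zero.2 fun h => htuv (h ▸ hs))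
      rw [hs0, abs_zero] at h1
      nlinarith [mul_pos hm' h2]
  · obtain ⟨ε, hε, h⟩ := Metric.eventually_nhds_iff.1 (hf.continuousAt.eventually_ne hft)
    simp only [Real.dist_eq] at h
    refine ⟨ε, hε, fun u v huv hu hv =>
      approximatesHalfCount_of_ne_zero hf.continuousOn fun s hs => ?_⟩
    rw [abs_lt] at hu hv
    exact h (abs_lt.2 ⟨by linarith [hs.1], by linarith [hs.2]⟩)

/-- If all zeros of `f` in `[a, b]` are simple and the weight there is the absolute value of the
derivative, the approximate counting integrals converge to the number of zeros. -/
theorem approximatesHalfCount_of_simple_zeros {f k : ℝ → ℝ} (hf : Continuous f)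
    (hk : Continuous k) {a b : ℝ} (hab : a ≤ b)
    (hz : ∀ t ∈ Icc a b, f t = 0 → ∃ m, m ≠ 0 ∧ HasDerivAt f m t ∧ k t = |m|) :
    ApproximatesHalfCount f k a b := by
  choose! ε hε h using fun t (ht : t ∈ Icc a b) => exists_forall_approximatesHalfCount hf hk (hz t ht)
  obtain ⟨τ, h0, hmono, ⟨n, hn⟩, hsub⟩ := exists_monotone_Icc_subset_open_cover_Icc hab
    (c := fun (t : Icc a b) => {x : Icc a b | |(x : ℝ) - t| < ε t})
    (fun t => isOpen_lt (by fun_prop) continuous_const)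
    (fun t _ => mem_iUnion.2 ⟨t, by simpa using hε t t.2⟩)
  have key : ∀ i, ApproximatesHalfCount f k a (τ i) := by
    intro i
    induction i with
    | zero => rw [h0]; exact approximatesHalfCount_self _ _ _
    | succ i ih =>
      obtain ⟨t, ht⟩ := hsub i
      have hle : τ i ≤ τ (i + 1) := hmono (Nat.le_succ i)
      exact ih.trans (h t t.2 _ _ hle (ht (left_mem_Icc.2 hle)) (ht (right_mem_Icc.2 hle)))
        (τ i).2.1 hle
  simpa [hn n le_rfl] using key n

/-! ### A uniform bound for the approximate counting integrals -/

/-- A value below `δ` forces a zero within time `δ / c` if the slope is at least `c`, by the mean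
value and intermediate value theorems. -/
theorem exists_zero_of_le_deriv {f f' : ℝ → ℝ} {t c τ δ : ℝ} (hc : 0 < c) (hδ : 0 < δ)
    (hδτ : δ < c * τ) (hd : ∀ s, |s - t| < τ → HasDerivAt f (f' s) s)
    (hf' : ∀ s, |s - t| < τ → c ≤ f' s) (ht : |f t| < δ) :
    ∃ z, |z - t| ≤ δ / c ∧ f z = 0 := by
  have hδc : 0 < δ / c := by positivity
  have hη : δ / c < τ := by rwa [div_lt_iff₀' hc]
  have hin : ∀ s ∈ Icc (t - δ / c) (t + δ / c), |s - t| < τ := fun s hs =>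
    (abs_le.2 ⟨by linarith [hs.1], by linarith [hs.2]⟩ : |s - t| ≤ δ / c).trans_lt hη
  have hcont : ContinuousOn f (Icc (t - δ / c) (t + δ / c)) := fun s hs =>
    (hd s (hin s hs)).continuousAt.continuousWithinAt
  have hmv := (convex_Icc (t - δ / c) (t + δ / c)).mul_sub_le_image_sub_of_le_deriv hcont
    (fun s hs => (hd s (hin s (interior_subset hs))).differentiableAt.differentiableWithinAt)
    (C := c) (fun s hs => by
      rw [(hd s (hin s (interior_subset hs))).deriv]
      exact hf' s (hin s (interior_subset hs)))
  have hm : t ∈ Icc (t - δ / c) (t + δ / c) := ⟨by linarith, by linarith⟩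
  have h1 := hmv t hm (t + δ / c) ⟨by linarith, le_rfl⟩ (by linarith)
  have h2 := hmv (t - δ / c) ⟨le_rfl, by linarith⟩ t hm (by linarith)
  rw [abs_lt] at ht
  rw [show c * (t + δ / c - t) = δ by field_simp; ring] at h1
  rw [show c * (t - (t - δ / c)) = δ by field_simp; ring] at h2
  obtain ⟨z, hz, hz0⟩ := intermediate_value_Icc (by linarith) hcont
    (show (0 : ℝ) ∈ Icc _ _ from ⟨by linarith, by linarith⟩)
  exact ⟨z, abs_le.2 ⟨by linarith [hz.1], by linarith [hz.2]⟩, hz0⟩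

theorem exists_zero_of_le_abs_deriv {f f' : ℝ → ℝ} {t c τ δ : ℝ} (hc : 0 < c) (hδ : 0 < δ)
    (hδτ : δ < c * τ) (hcf' : Continuous f') (hd : ∀ s, |s - t| < τ → HasDerivAt f (f' s) s)
    (hf' : ∀ s, |s - t| < τ → c ≤ |f' s|) (ht : |f t| < δ) :
    ∃ z, |z - t| ≤ δ / c ∧ f z = 0 := by
  have hτ : 0 < τ := by
    by_contra! h
    nlinarith
  have hball : {s | |s - t| < τ} = Metric.ball t τ := by
    ext s
    simp [Real.dist_eq]
  have hpre : IsPreconnected {s | |s - t| < τ} := by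
    rw [hball]
    exact (convex_ball t τ).isPreconnected
  have htm : t ∈ {s | |s - t| < τ} := by simpa using hτ
  -- a continuous function without zeros on an interval has a constant sign
  have hsign : (∀ s, |s - t| < τ → 0 < f' s) ∨ ∀ s, |s - t| < τ → f' s < 0 := by
    by_contra! h
    obtain ⟨⟨s₁, h1, h1'⟩, s₂, h2, h2'⟩ := h
    obtain ⟨s, hs, hs0⟩ := hpre.intermediate_value (show s₁ ∈ _ from h1) (show s₂ ∈ _ from h2)
      hcf'.continuousOn ⟨h1', h2'⟩
    have := hf' s hs
    rw [hs0, abs_zero] at this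
    linarith
  rcases hsign with h | h
  · exact exists_zero_of_le_deriv hc hδ hδτ hd
      (fun s hs => by simpa [abs_of_pos (h s hs)] using hf' s hs) ht
  · obtain ⟨z, hz, hz0⟩ := exists_zero_of_le_deriv (f := fun s => -f s) (f' := fun s => -f' s)
      hc hδ hδτ (fun s hs => (hd s hs).neg)
      (fun s hs => by simpa [abs_of_neg (h s hs)] using hf' s hs) (by simpa using ht)
    exact ⟨z, hz, by simpa using hz0⟩

/-- Where the weight `k` does not vanish, `f` is so steep for a time `τ` that a value below `δ`
forces a zero within time `δ / c`; hence the times that count lie within `δ / c` of the zeros or of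
the endpoints. -/
theorem lintegral_levelKernel_le {f f' k : ℝ → ℝ} {a b c τ δ C : ℝ} {N : ℕ} (hc : 0 < c)
    (hδ : 0 < δ) (hδτ : δ < c * τ) (hC : 0 ≤ C) (hkC : ∀ s, k s ≤ C) (hcf' : Continuous f')
    (hd : ∀ t, k t ≠ 0 → ∀ s, |s - t| < τ → HasDerivAt f (f' s) s ∧ c ≤ |f' s|)
    (hN : ({t | f t = 0} ∩ Ioo a b).encard ≤ N) :
    ∫⁻ s in Ioc a b, levelKernel δ (f s) (k s) ≤ ENNReal.ofReal ((N + 1) * C / c) := by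
  have hfin : ({t | f t = 0} ∩ Ioo a b).Finite :=
    finite_of_encard_le_coe hN
  obtain ⟨Z, hZ⟩ := hfin.exists_finset_coe
  have hZN : Z.card ≤ N := by
    rw [← hZ, encard_coe_eq_coe_finsetCard] at hN
    exact_mod_cast hN
  set η := δ / c with hη
  have hη0 : 0 < η := by positivity
  -- the zero that a time forces may lie outside `(a, b)`; then the time is close to an endpoint
  set B : Set ℝ := Icc a (a + η) ∪ Icc (b - η) b ∪ ⋃ z ∈ Z, Icc (z - η) (z + η) with hB
  have hBm : MeasurableSet B :=
    (measurableSet_Icc.union measurableSet_Icc).union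
      (Z.measurableSet_biUnion fun _ _ => measurableSet_Icc)
  have hle : ∀ s ∈ Ioc a b, levelKernel δ (f s) (k s) ≤
      B.indicator (fun _ => ENNReal.ofReal ((2 * δ)⁻¹ * C)) s := by
    intro s hs
    by_cases hsB : s ∈ B
    · rw [indicator_of_mem hsB]
      exact levelKernel_le hδ (hkC s)
    · rw [indicator_of_notMem hsB, nonpos_iff_eq_zero]
      by_contra hne
      have hks : k s ≠ 0 := fun h => hne (by simp [h])
      have hfs : |f s| < δ := by
        by_contra! h
        exact hne (levelKernel_of_le h)
      obtain ⟨z, hz, hz0⟩ := exists_zero_of_le_abs_deriv hc hδ hδτ hcf'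
        (fun u hu => (hd s hks u hu).1) (fun u hu => (hd s hks u hu).2) hfs
      rw [abs_le] at hz
      simp only [hB, mem_union, mem_iUnion, not_or, not_exists, mem_Icc, not_and, not_le] at hsB
      have h1 := hsB.1.1 hs.1.le
      have h2 : s < b - η := by
        by_contra! h
        exact (hsB.1.2 h).not_ge hs.2
      have hzZ : z ∈ Z := by
        rw [← Finset.mem_coe, hZ]
        exact ⟨hz0, by linarith [hz.1], by linarith [hz.2]⟩
      have h3 := hsB.2 z hzZ (by linarith [hz.2])
      linarith [hz.1]
  have hvol : volume B ≤ ENNReal.ofReal ((N + 1) * (2 * η)) := by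
    calc volume B ≤ volume (Icc a (a + η)) + volume (Icc (b - η) b) +
          ∑ z ∈ Z, volume (Icc (z - η) (z + η)) := by
          refine (measure_union_le _ _).trans (add_le_add (measure_union_le _ _) ?_)
          exact measure_biUnion_finset_le _ _
      _ = ENNReal.ofReal η + ENNReal.ofReal η + Z.card * ENNReal.ofReal (2 * η) := by
          simp only [Real.volume_Icc, Finset.sum_const, add_sub_cancel_left, sub_sub_cancel,
            show ∀ z, z + η - (z - η) = 2 * η from fun z => by ring, nsmul_eq_mul, Finset.sum_const]
      _ = ENNReal.ofReal ((Z.card + 1) * (2 * η)) := by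
          rw [← ENNReal.ofReal_add hη0.le hη0.le, ← ENNReal.ofReal_natCast,
            ← ENNReal.ofReal_mul (by positivity), ← ENNReal.ofReal_add (by positivity) (by positivity)]
          congr 1
          ring
      _ ≤ _ := by
          gcongr
  calc ∫⁻ s in Ioc a b, levelKernel δ (f s) (k s)
      ≤ ∫⁻ s in Ioc a b, B.indicator (fun _ => ENNReal.ofReal ((2 * δ)⁻¹ * C)) s :=
        setLIntegral_mono' measurableSet_Ioc hle
    _ ≤ ∫⁻ s, B.indicator (fun _ => ENNReal.ofReal ((2 * δ)⁻¹ * C)) s := setLIntegral_le_lintegral _ _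
    _ = ENNReal.ofReal ((2 * δ)⁻¹ * C) * volume B := by
        rw [lintegral_indicator hBm, setLIntegral_const]
    _ ≤ ENNReal.ofReal ((2 * δ)⁻¹ * C) * ENNReal.ofReal ((N + 1) * (2 * η)) := by gcongr
    _ = _ := by
        rw [← ENNReal.ofReal_mul (by positivity), hη]
        congr 1
        field_simp

/-! ### The flow -/

section Flow

variable {d : ℕ} {U : Set (EuclideanSpace ℝ (Fin d))}
  {r : EuclideanSpace ℝ (Fin d) → EuclideanSpace ℝ (Fin d)}
  {φ : EuclideanSpace ℝ (Fin d) → ℝ → EuclideanSpace ℝ (Fin d)}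

/-- Two solutions of `x' = r x` that agree at one time agree on the whole interval. The set of times
near which they agree is open and, by local uniqueness, relatively closed. -/
theorem eqOn_of_hasDerivAt (hU : IsOpen U) (hr : ContDiffOn ℝ 1 r U) {J : Set ℝ} (hJ : IsOpen J)
    (hJc : IsPreconnected J) {f g : ℝ → EuclideanSpace ℝ (Fin d)}
    (hf : ∀ t ∈ J, HasDerivAt f (r (f t)) t ∧ f t ∈ U)
    (hg : ∀ t ∈ J, HasDerivAt g (r (g t)) t ∧ g t ∈ U) {t₀ : ℝ} (ht₀ : t₀ ∈ J)
    (h : f t₀ = g t₀) : EqOn f g J := by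
  have hloc : ∀ t ∈ J, f t = g t → f =ᶠ[𝓝 t] g := by
    intro t ht hfg
    obtain ⟨K, s, hs, hK⟩ :=
      ((hr.contDiffAt (hU.mem_nhds (hf t ht).2)).of_le le_rfl).exists_lipschitzOnWith
    have h1 : ∀ᶠ u in 𝓝 t, f u ∈ s := (hf t ht).1.continuousAt.eventually_mem hs
    have h2 : ∀ᶠ u in 𝓝 t, g u ∈ s := (hg t ht).1.continuousAt.eventually_mem (hfg ▸ hs)
    refine ODE_solution_unique_of_eventually (v := fun _ => r) (s := fun _ => s)
      (Eventually.of_forall fun _ => hK) ?_ ?_ hfg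
    · filter_upwards [h1, hJ.mem_nhds ht] with u hu huJ using ⟨(hf u huJ).1, hu⟩
    · filter_upwards [h2, hJ.mem_nhds ht] with u hu huJ using ⟨(hg u huJ).1, hu⟩
  have hsub : J ⊆ {t | f =ᶠ[𝓝 t] g} := by
    refine hJc.subset_of_closure_inter_subset isOpen_setOfPred_eventually_nhds
      ⟨t₀, ht₀, hloc t₀ ht₀ h⟩ ?_
    rintro t ⟨hcl, htJ⟩
    refine hloc t htJ ?_
    rw [mem_closure_iff_frequently] at hcl
    have hcl' : ∃ᶠ u in 𝓝 t, f u - g u ∈ ({0} : Set (EuclideanSpace ℝ (Fin d))) :=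
      hcl.mono fun u hu => sub_eq_zero.2 hu.self_of_nhds
    exact sub_eq_zero.1 (isClosed_singleton.mem_of_frequently_of_tendsto hcl'
      ((hf t htJ).1.continuousAt.sub (hg t htJ).1.continuousAt).tendsto)
  exact fun t ht => (hsub ht).self_of_nhds

theorem IsGlobalFlow.continuous (hφ : IsGlobalFlow U r φ) {ζ : EuclideanSpace ℝ (Fin d)}
    (hζ : ζ ∈ U) : Continuous (φ ζ) :=
  continuous_iff_continuousAt.2 fun t => (hφ.hasDerivAt ζ hζ t).continuousAt

/-- The flow property, a consequence of uniqueness. -/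
theorem IsGlobalFlow.apply_apply (hφ : IsGlobalFlow U r φ) (hU : IsOpen U)
    (hr : ContDiffOn ℝ 1 r U) {ζ : EuclideanSpace ℝ (Fin d)} (hζ : ζ ∈ U) (s t : ℝ) :
    φ (φ ζ s) t = φ ζ (s + t) := by
  have hs := hφ.mem ζ hζ s
  refine eqOn_of_hasDerivAt hU hr isOpen_univ isPreconnected_univ
    (g := fun t => φ ζ (s + t)) (fun t _ => ⟨hφ.hasDerivAt _ hs t, hφ.mem _ hs t⟩)
    (fun t _ => ⟨?_, hφ.mem ζ hζ (s + t)⟩) (mem_univ 0) ?_ (mem_univ t)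
  · exact HasDerivAt.comp_const_add s t (hφ.hasDerivAt ζ hζ (s + t))
  · simp [hφ.map_zero _ hs]

/-- Joint continuity of the flow for short times: the local flow of the Picard-Lindelöf theorem is
continuous and coincides with `φ` by uniqueness. -/
theorem IsGlobalFlow.exists_continuousAt (hφ : IsGlobalFlow U r φ) (hU : IsOpen U)
    (hr : ContDiffOn ℝ 1 r U) {x₀ : EuclideanSpace ℝ (Fin d)} (hx₀ : x₀ ∈ U) :
    ∃ ε > 0, ∀ x t, dist x x₀ < ε → |t| < ε → ContinuousAt (Function.uncurry φ) (x, t) := by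
  obtain ⟨ε, hε, a, R, L, K, hR, hpl⟩ :=
    IsPicardLindelof.of_contDiffAt_one (hr.contDiffAt (hU.mem_nhds hx₀))
  obtain ⟨α, hα, hαc⟩ := (hpl 0).exists_forall_mem_closedBall_eq_hasDerivWithinAt_continuousOn
  simp only [zero_sub, zero_add] at hα hαc
  have hmem : Metric.closedBall x₀ R ×ˢ Icc (-ε) ε ∈ 𝓝 (x₀, (0 : ℝ)) :=
    prod_mem_nhds (Metric.closedBall_mem_nhds _ hR) (Icc_mem_nhds (by linarith) hε)
  have hcont : ContinuousAt α (x₀, 0) := hαc.continuousAt hmem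
  have hα0 : α (x₀, 0) = x₀ := (hα x₀ (Metric.mem_closedBall_self hR.le)).1
  have hev : ∀ᶠ z in 𝓝 (x₀, (0 : ℝ)), α z ∈ U :=
    hcont.eventually_mem (by rw [hα0]; exact hU.mem_nhds hx₀)
  obtain ⟨η, hη, hball⟩ := Metric.eventually_nhds_iff.1 hev
  obtain ⟨η', hη', hballU⟩ := Metric.isOpen_iff.1 hU x₀ hx₀
  set κ := min (min ε R) (min η η') with hκ
  have hκ0 : 0 < κ := lt_min (lt_min hε hR) (lt_min hη hη')
  have hκε : κ ≤ ε := (min_le_left _ _).trans (min_le_left _ _)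
  have hκR : κ ≤ R := (min_le_left _ _).trans (min_le_right _ _)
  have hκη : κ ≤ η := (min_le_right _ _).trans (min_le_left _ _)
  have hκη' : κ ≤ η' := (min_le_right _ _).trans (min_le_right _ _)
  have heq : ∀ x t, dist x x₀ < κ → |t| < κ → φ x t = α (x, t) := by
    intro x t hx ht
    have hxU : x ∈ U := hballU (hx.trans_le hκη')
    have hxR : x ∈ Metric.closedBall x₀ R := (hx.trans_le hκR).le
    refine eqOn_of_hasDerivAt hU hr (J := Ioo (-κ) κ) isOpen_Ioo isPreconnected_Ioo
      (g := fun t => α (x, t)) (fun t _ => ⟨hφ.hasDerivAt x hxU t, hφ.mem x hxU t⟩)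
      (fun t ht => ⟨?_, ?_⟩) (t₀ := 0) (by simpa using hκ0) ?_ (abs_lt.1 ht)
    · exact ((hα x hxR).2 t ⟨by linarith [ht.1], by linarith [ht.2]⟩).hasDerivAt
        (Icc_mem_nhds (by linarith [ht.1]) (by linarith [ht.2]))
    · refine hball ?_
      rw [Prod.dist_eq]
      refine max_lt (hx.trans_le hκη) ?_
      rw [Real.dist_eq, sub_zero]
      exact (abs_lt.2 ht).trans_le hκη
    · rw [hφ.map_zero x hxU, (hα x hxR).1]
  refine ⟨κ, hκ0, fun x t hx ht => ?_⟩
  have hnhds : Metric.ball x₀ κ ×ˢ Ioo (-κ) κ ∈ 𝓝 (x, t) :=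
    prod_mem_nhds (Metric.isOpen_ball.mem_nhds hx) (isOpen_Ioo.mem_nhds (abs_lt.1 ht))
  have h1 : ContinuousAt α (x, t) := by
    refine hαc.continuousAt (mem_of_superset hnhds (prod_mono ?_ ?_))
    · exact Metric.ball_subset_closedBall.trans (Metric.closedBall_subset_closedBall hκR)
    · exact Ioo_subset_Icc_self.trans (Icc_subset_Icc (by linarith) hκε)
  refine h1.congr ?_
  filter_upwards [hnhds] with z hz
  exact (heq z.1 z.2 hz.1 (abs_lt.2 hz.2)).symm

/-- Joint continuity of the flow. For a fixed point `x₀`, the times `t` with continuity at `(x₀, t)`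
form a clopen set, because the flow property carries continuity from one time to all close ones. -/
theorem IsGlobalFlow.continuousAt (hφ : IsGlobalFlow U r φ) (hU : IsOpen U)
    (hr : ContDiffOn ℝ 1 r U) {x₀ : EuclideanSpace ℝ (Fin d)} (hx₀ : x₀ ∈ U) (t₀ : ℝ) :
    ContinuousAt (Function.uncurry φ) (x₀, t₀) := by
  set A : Set ℝ := {t | ContinuousAt (Function.uncurry φ) (x₀, t)} with hA
  -- continuity at one time close to `t₁` gives continuity at all times close to `t₁`
  have hloc : ∀ t₁, ∃ ε > 0, ∀ t t', |t - t₁| < ε → |t' - t₁| < ε → t ∈ A → t' ∈ A := by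
    intro t₁
    obtain ⟨ε, hε, h⟩ := hφ.exists_continuousAt hU hr (hφ.mem x₀ hx₀ t₁)
    obtain ⟨η, hη, hball⟩ := Metric.continuousAt_iff.1 (hφ.continuous hx₀).continuousAt ε hε
    refine ⟨min (ε / 2) η, lt_min (half_pos hε) hη, fun t t' ht ht' htA => ?_⟩
    have h1 : ContinuousAt (Function.uncurry φ) (φ x₀ t, t' - t) := by
      refine h _ _ (hball (by rw [Real.dist_eq]; exact ht.trans_le (min_le_right _ _))) ?_
      have e1 := abs_lt.1 (ht.trans_le (min_le_left _ _))
      have e2 := abs_lt.1 (ht'.trans_le (min_le_left _ _))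
      exact abs_lt.2 ⟨by linarith [e1.1, e2.1, e1.2, e2.2], by linarith [e1.1, e2.1, e1.2, e2.2]⟩
    have h2 : ContinuousAt (fun z : EuclideanSpace ℝ (Fin d) × ℝ => (φ z.1 t, z.2 - t)) (x₀, t') := by
      refine ContinuousAt.prodMk ?_ (by fun_prop)
      have h3 : ContinuousAt (fun z : EuclideanSpace ℝ (Fin d) × ℝ => (z.1, t)) (x₀, t') := by
        fun_prop
      exact ContinuousAt.comp (x := (x₀, t')) (g := Function.uncurry φ)
        (f := fun z : EuclideanSpace ℝ (Fin d) × ℝ => (z.1, t)) htA h3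
    have h4 := ContinuousAt.comp (g := Function.uncurry φ)
      (f := fun z : EuclideanSpace ℝ (Fin d) × ℝ => (φ z.1 t, z.2 - t)) h1 h2
    refine ContinuousAt.congr h4 ?_
    filter_upwards [prod_mem_nhds (hU.mem_nhds hx₀) univ_mem] with z hz
    simp [Function.uncurry, hφ.apply_apply hU hr hz.1]
  have hopen : IsOpen A := by
    refine isOpen_iff_mem_nhds.2 fun t₁ ht₁ => ?_
    obtain ⟨ε, hε, h⟩ := hloc t₁
    filter_upwards [Metric.ball_mem_nhds t₁ hε] with t ht
    exact h t₁ t (by simpa using hε) (by simpa [Real.dist_eq] using ht) ht₁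
  have hclosed : IsClosed A := by
    refine isClosed_of_closure_subset fun t₁ ht₁ => ?_
    obtain ⟨ε, hε, h⟩ := hloc t₁
    obtain ⟨t, htA, ht⟩ := Metric.mem_closure_iff.1 ht₁ ε hε
    exact h t t₁ (by rwa [dist_comm, Real.dist_eq] at ht) (by simpa using hε) htA
  have h0 : (0 : ℝ) ∈ A := by
    obtain ⟨ε, hε, h⟩ := hφ.exists_continuousAt hU hr hx₀
    exact h x₀ 0 (by simpa using hε) (by simpa using hε)
  have hA' : A = univ := IsClopen.eq_univ ⟨hclosed, hopen⟩ ⟨0, h0⟩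
  have ht₀ : t₀ ∈ A := hA' ▸ mem_univ t₀
  exact ht₀

theorem IsGlobalFlow.continuousOn (hφ : IsGlobalFlow U r φ) (hU : IsOpen U)
    (hr : ContDiffOn ℝ 1 r U) :
    ContinuousOn (Function.uncurry φ) (U ×ˢ univ) :=
  fun z hz => (hφ.continuousAt hU hr hz.1 z.2).continuousWithinAt

end Flow

/-! ### Layers around a level set -/

section Measures

open Measure

theorem _root_.LipschitzWith.euclideanHausdorffMeasure_image_le {X Y : Type*} [EMetricSpace X]
    [EMetricSpace Y] [MeasurableSpace X] [BorelSpace X] [MeasurableSpace Y] [BorelSpace Y]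
    {K : NNReal} {f : X → Y} (hf : LipschitzWith K f) (n : ℕ) (s : Set X) :
    μHE[n] (f '' s) ≤ (K : ℝ≥0∞) ^ n * μHE[n] s := by
  have h := hf.hausdorffMeasure_image_le (Nat.cast_nonneg n) s
  rw [ENNReal.rpow_natCast] at h
  simp only [euclideanHausdorffMeasure_def, Measure.smul_apply, ENNReal.smul_def, smul_eq_mul]
  calc _ ≤ _ := mul_le_mul_right h _
    _ = _ := by ring

theorem _root_.AntilipschitzWith.le_euclideanHausdorffMeasure_image {X Y : Type*} [EMetricSpace X]
    [EMetricSpace Y] [MeasurableSpace X] [BorelSpace X] [MeasurableSpace Y] [BorelSpace Y]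
    {K : NNReal} {f : X → Y} (hf : AntilipschitzWith K f) (n : ℕ) (s : Set X) :
    μHE[n] s ≤ (K : ℝ≥0∞) ^ n * μHE[n] (f '' s) := by
  have h := hf.le_hausdorffMeasure_image (Nat.cast_nonneg n) s
  rw [ENNReal.rpow_natCast] at h
  simp only [euclideanHausdorffMeasure_def, Measure.smul_apply, ENNReal.smul_def, smul_eq_mul]
  calc _ ≤ _ := mul_le_mul_right h _
    _ = _ := by ring

variable {E : Type*} [NormedAddCommGroup E] [InnerProductSpace ℝ E] [FiniteDimensional ℝ E]
  [MeasurableSpace E] [BorelSpace E]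

/-- Integration along the lines in the direction of a unit vector `e`. -/
theorem lintegral_eq_lintegral_lintegral_line {e : E} (he : ‖e‖ = 1) {Φ : E → ℝ≥0∞}
    (hΦ : Measurable Φ) :
    ∫⁻ x, Φ x = ∫⁻ y : (ℝ ∙ e)ᗮ, ∫⁻ t : ℝ, Φ (t • e + (y : E)) := by
  have h1 := (ℝ ∙ e).measurePreserving_measurableEquivProd (0 : E)
  rw [InnerProductSpace.euclideanHausdorffMeasure_eq_volume] at h1
  have h2 := h1.symm.lintegral_comp_emb (MeasurableEquiv.measurableEmbedding _) Φ
  rw [← h2, Measure.volume_eq_prod, lintegral_prod_symm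
    (fun z => Φ (((ℝ ∙ e).measurableEquivProd (0 : E)).symm z))
    ((hΦ.comp (MeasurableEquiv.measurable _)).aemeasurable)]
  refine lintegral_congr fun y => ?_
  have h3 := (LinearIsometryEquiv.toSpanUnitSingleton (𝕜 := ℝ) e he).measurePreserving
  rw [← h3.lintegral_comp_emb
    (LinearIsometryEquiv.toSpanUnitSingleton (𝕜 := ℝ) e he).toHomeomorph.measurableEmbedding]
  refine lintegral_congr fun t => ?_
  simp

end Measures

section Line

variable {E : Type*} [NormedAddCommGroup E] [InnerProductSpace ℝ E]

/-- The orthogonal projection onto the hyperplane orthogonal to `e`. -/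
noncomputable def hyperplaneProj (e : E) : E →L[ℝ] (ℝ ∙ e)ᗮ := (ℝ ∙ e)ᗮ.orthogonalProjectionOnto

theorem inner_smul_add_hyperplaneProj {e : E} (he : ‖e‖ = 1) (x : E) :
    (inner ℝ e x : ℝ) • e + (hyperplaneProj e x : E) = x := by
  rw [← Submodule.starProjection_unit_singleton ℝ he]
  exact Submodule.starProjection_add_starProjection_orthogonal x

theorem hyperplaneProj_smul_add (e : E) (t : ℝ) (y : (ℝ ∙ e)ᗮ) :
    hyperplaneProj e (t • e + (y : E)) = y := by
  rw [map_add, map_smul]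
  simp [hyperplaneProj]

theorem norm_hyperplaneProj_le (e x : E) : ‖hyperplaneProj e x‖ ≤ ‖x‖ :=
  Submodule.norm_orthogonalProjectionOnto_apply_le _ _

theorem norm_sq_eq_inner_sq_add_hyperplaneProj {e : E} (he : ‖e‖ = 1) (x : E) :
    ‖x‖ ^ 2 = (inner ℝ e x : ℝ) ^ 2 + ‖hyperplaneProj e x‖ ^ 2 := by
  rw [Submodule.norm_sq_eq_add_norm_sq_projection x (ℝ ∙ e)]
  congr 1
  rw [show ‖(ℝ ∙ e).orthogonalProjectionOnto x‖ = ‖(ℝ ∙ e).starProjection x‖ from rfl,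
    Submodule.starProjection_unit_singleton ℝ he, norm_smul, he, mul_one, Real.norm_eq_abs, sq_abs]

end Line

/-- On the ball `ball x₀ R`, the function `ρ` is, up to a relative error `ε`, the linear function
with gradient `a • e`. -/
structure IsAlmostLinear {E : Type*} [NormedAddCommGroup E] [InnerProductSpace ℝ E]
    [CompleteSpace E] (ρ : E → ℝ) (x₀ : E) (R a ε : ℝ) (e : E) : Prop where
  norm_eq : ‖e‖ = 1
  pos : 0 < a
  nonneg : 0 ≤ ε
  lt_one : ε < 1
  abs_sub_le : ∀ x ∈ Metric.ball x₀ R, ∀ y ∈ Metric.ball x₀ R,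
    |ρ x - ρ y - a * inner ℝ e (x - y)| ≤ ε * a * ‖x - y‖
  gradient_sub_le : ∀ x ∈ Metric.ball x₀ R, ‖∇ ρ x - a • e‖ ≤ ε * a

section AlmostLinear

variable {E : Type*} [NormedAddCommGroup E] [InnerProductSpace ℝ E] [FiniteDimensional ℝ E]
  {ρ : E → ℝ} {x₀ e : E} {R a ε : ℝ}

/-- A `C¹` function is almost linear on small balls around a regular point, by strict
differentiability and continuity of the gradient. -/
theorem exists_isAlmostLinear (hρ : ContDiff ℝ 1 ρ) (hx₀ : ∇ ρ x₀ ≠ 0) {W : Set E} (hW : W ∈ 𝓝 x₀)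
    (hε : 0 < ε) (hε1 : ε < 1) :
    ∃ R > 0, ∃ a e, Metric.ball x₀ R ⊆ W ∧ IsAlmostLinear ρ x₀ R a ε e := by
  set a := ‖∇ ρ x₀‖ with ha
  have ha0 : 0 < a := norm_pos_iff.2 hx₀
  set e := a⁻¹ • ∇ ρ x₀ with he
  have hae : a • e = ∇ ρ x₀ := by rw [he, smul_smul, mul_inv_cancel₀ ha0.ne', one_smul]
  have h1 := ((hρ.contDiffAt (x := x₀)).hasStrictFDerivAt one_ne_zero).isLittleO.def
    (mul_pos hε ha0)
  obtain ⟨R₁, hR₁, hball₁⟩ := Metric.eventually_nhds_iff.1 h1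
  have hgc : Continuous (∇ ρ) :=
    (InnerProductSpace.toDual ℝ E).symm.continuous.comp (hρ.continuous_fderiv one_ne_zero)
  obtain ⟨R₂, hR₂, hball₂⟩ := Metric.continuousAt_iff.1 (hgc.continuousAt (x := x₀)) (ε * a)
    (mul_pos hε ha0)
  obtain ⟨R₃, hR₃, hball₃⟩ := Metric.mem_nhds_iff.1 hW
  refine ⟨min (min R₁ R₂) R₃, by positivity, a, e,
    (Metric.ball_subset_ball (min_le_right _ _)).trans hball₃, ?_, ha0, hε.le, hε1, ?_, ?_⟩
  · rw [he, norm_smul, norm_inv, Real.norm_of_nonneg ha0.le, ← ha, inv_mul_cancel₀ ha0.ne']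
  · intro x hx y hy
    have hx' : dist x x₀ < R₁ := (Metric.mem_ball.1 hx).trans_le
      ((min_le_left _ _).trans (min_le_left _ _))
    have hy' : dist y x₀ < R₁ := (Metric.mem_ball.1 hy).trans_le
      ((min_le_left _ _).trans (min_le_left _ _))
    have h2 := hball₁ (y := (x, y)) (by rw [Prod.dist_eq]; exact max_lt hx' hy')
    rwa [← inner_gradient_left, ← hae, inner_smul_left, Real.norm_eq_abs] at h2
  · intro x hx
    have hx' : dist x x₀ < R₂ := (Metric.mem_ball.1 hx).trans_le
      ((min_le_left _ _).trans (min_le_right _ _))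
    rw [hae, ← dist_eq_norm]
    exact (hball₂ hx').le

namespace IsAlmostLinear

/-- Along lines in the direction of `e`, the function grows at least at the rate `a (1 - ε)`. -/
theorem le_abs_sub_of_line (h : IsAlmostLinear ρ x₀ R a ε e) {s t : ℝ} {y : E}
    (hs : s • e + y ∈ Metric.ball x₀ R) (ht : t • e + y ∈ Metric.ball x₀ R) :
    a * (1 - ε) * |s - t| ≤ |ρ (s • e + y) - ρ (t • e + y)| := by
  have h1 := h.abs_sub_le _ hs _ ht
  have h2 : s • e + y - (t • e + y) = (s - t) • e := by rw [sub_smul]; abel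
  rw [h2, inner_smul_right, real_inner_self_eq_norm_sq, norm_smul, h.norm_eq, Real.norm_eq_abs] at h1
  have h3 : |a * ((s - t) * 1 ^ 2)| - |ρ (s • e + y) - ρ (t • e + y)| ≤
      |ρ (s • e + y) - ρ (t • e + y) - a * ((s - t) * 1 ^ 2)| :=
    (abs_sub_abs_le_abs_sub _ _).trans_eq (abs_sub_comm _ _)
  rw [abs_mul, abs_of_pos h.pos, one_pow, mul_one] at h3
  simp only [one_pow, mul_one] at h1
  nlinarith

theorem abs_inner_gradient_sub_le (h : IsAlmostLinear ρ x₀ R a ε e) {x : E}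
    (hx : x ∈ Metric.ball x₀ R) : |inner ℝ (∇ ρ x) e - a| ≤ ε * a := by
  have h1 := abs_real_inner_le_norm (∇ ρ x - a • e) e
  rw [inner_sub_left, inner_smul_left, real_inner_self_eq_norm_sq, h.norm_eq] at h1
  simp only [one_pow, mul_one, conj_trivial] at h1
  exact h1.trans (h.gradient_sub_le x hx)

theorem abs_norm_gradient_sub_le (h : IsAlmostLinear ρ x₀ R a ε e) {x : E}
    (hx : x ∈ Metric.ball x₀ R) : |‖∇ ρ x‖ - a| ≤ ε * a := by
  have h1 := abs_norm_sub_norm_le (∇ ρ x) (a • e)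
  rw [norm_smul, h.norm_eq, Real.norm_of_nonneg h.pos.le, mul_one] at h1
  exact h1.trans (h.gradient_sub_le x hx)

/-- Two points of the same level differ mostly in directions orthogonal to `e`. -/
theorem norm_sub_le (h : IsAlmostLinear ρ x₀ R a ε e) {x y : E} (hx : x ∈ Metric.ball x₀ R)
    (hy : y ∈ Metric.ball x₀ R) (hxy : ρ x = ρ y) :
    ‖x - y‖ ≤ (1 - ε)⁻¹ * ‖hyperplaneProj e x - hyperplaneProj e y‖ := by
  have h1 := h.abs_sub_le x hx y hy
  have hε := sub_pos.2 h.lt_one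
  rw [hxy, sub_self, zero_sub, abs_neg, abs_mul, abs_of_pos h.pos] at h1
  have h2 : |(inner ℝ e (x - y) : ℝ)| ≤ ε * ‖x - y‖ := by
    have := h.pos
    nlinarith
  have h3 := norm_sq_eq_inner_sq_add_hyperplaneProj h.norm_eq (x - y)
  rw [← sq_abs (inner ℝ e (x - y) : ℝ), map_sub] at h3
  rw [inv_mul_eq_div, le_div_iff₀ hε]
  refine abs_le_of_sq_le_sq' ?_ (norm_nonneg _) |>.2
  have h4 : |(inner ℝ e (x - y) : ℝ)| ^ 2 ≤ (ε * ‖x - y‖) ^ 2 :=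
    pow_le_pow_left₀ (abs_nonneg _) h2 2
  have h5 := h.nonneg
  nlinarith [mul_nonneg (mul_nonneg h5 hε.le) (sq_nonneg ‖x - y‖)]

end IsAlmostLinear

end AlmostLinear

theorem measurableSet_ball_inter_levelSet {E : Type*} [NormedAddCommGroup E] [MeasurableSpace E]
    [BorelSpace E] {ρ : E → ℝ} {x₀ : E} {R : ℝ} (hρ : Continuous ρ) :
    MeasurableSet (Metric.ball x₀ R ∩ ρ ⁻¹' {0} : Set E) :=
  measurableSet_ball.inter (hρ.measurable (measurableSet_singleton 0))

namespace IsAlmostLinear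

open Measure

variable {E : Type*} [NormedAddCommGroup E] [InnerProductSpace ℝ E] [FiniteDimensional ℝ E]
  {ρ : E → ℝ} {x₀ e : E} {R a ε : ℝ}

/-- On a line in the direction of `e` that meets the level set in the ball, the layer integral
converges; this is the one-dimensional statement for a simple zero. -/
theorem tendsto_line (hflat : IsAlmostLinear ρ x₀ R a ε e) (hρ : ContDiff ℝ 1 ρ) {h : E → ℝ} {C : ℝ}
    (hh : Continuous h) (hh0 : ∀ x, 0 ≤ h x) (hhC : ∀ x, h x ≤ C)
    (hhR : ∀ x, h x ≠ 0 → x ∈ Metric.ball x₀ R) {z : E} (hz : z ∈ Metric.ball x₀ R)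
    (hz0 : ρ z = 0) :
    Tendsto (fun δ => ∫⁻ t : ℝ, levelKernel δ (ρ (t • e + (hyperplaneProj e z : E)))
      (h (t • e + (hyperplaneProj e z : E)))) (𝓝[>] 0)
      (𝓝 (ENNReal.ofReal (h z / |inner ℝ (∇ ρ z) e|))) := by
  set y := hyperplaneProj e z
  set t₀ : ℝ := inner ℝ e z
  have hzt : t₀ • e + (y : E) = z := inner_smul_add_hyperplaneProj hflat.norm_eq z
  have hε := sub_pos.2 hflat.lt_one
  have hgrad := abs_le.1 (hflat.abs_inner_gradient_sub_le hz)
  have hm : (inner ℝ (∇ ρ z) e : ℝ) ≠ 0 := by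
    have := mul_pos hflat.pos hε
    have : 0 < (inner ℝ (∇ ρ z) e : ℝ) := by nlinarith [hgrad.1]
    exact this.ne'
  have hline : HasDerivAt (fun t : ℝ => t • e + (y : E)) e t₀ := by
    simpa using ((hasDerivAt_id t₀).smul_const e).add_const (y : E)
  have hder : HasDerivAt (fun t : ℝ => ρ (t • e + (y : E))) (inner ℝ (∇ ρ z) e) t₀ := by
    have h1 : HasFDerivAt ρ (fderiv ℝ ρ z) (t₀ • e + (y : E)) := by
      rw [hzt]
      exact (hρ.differentiable one_ne_zero z).hasFDerivAt
    rw [inner_gradient_left]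
    exact h1.comp_hasDerivAt t₀ hline
  have key := tendsto_lintegral_levelKernel_of_unique_zero
    (f := fun t : ℝ => ρ (t • e + (y : E))) (k := fun t : ℝ => h (t • e + (y : E)))
    (t := t₀) (c := a * (1 - ε)) (C := C)
    (hρ.continuous.comp (by fun_prop : Continuous fun t : ℝ => t • e + (y : E))).measurable
    (hh.comp (by fun_prop)) (by simp only [hzt, hz0]) hder hm (hh0 _) (fun s => hhC _)
    (mul_pos hflat.pos hε) (fun s hs => by
      have := hflat.le_abs_sub_of_line (hhR _ hs) (t := t₀) (by rw [hzt]; exact hz)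
      rwa [hzt, hz0, sub_zero] at this)
  simpa only [hzt] using key

/-- A line that misses the level set does not contribute: on the support of `h`, which is compact,
the function `ρ` stays away from `0`. -/
theorem tendsto_line_of_notMem (hρ : Continuous ρ) {h : E → ℝ}
    (hhR : tsupport h ⊆ Metric.ball x₀ R) (he : ‖e‖ = 1) {y : E}
    (hy : ∀ t : ℝ, t • e + y ∈ Metric.ball x₀ R → ρ (t • e + y) ≠ 0) :
    Tendsto (fun δ => ∫⁻ t : ℝ, levelKernel δ (ρ (t • e + y)) (h (t • e + y))) (𝓝[>] 0)
      (𝓝 0) := by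
  have hcomp : IsCompact (tsupport h ∩ range fun t : ℝ => t • e + y) := by
    refine IsCompact.inter_right ?_ ?_
    · exact Metric.isCompact_of_isClosed_isBounded (isClosed_tsupport h)
        (Metric.isBounded_ball.subset hhR)
    · have hiso : Isometry fun t : ℝ => t • e + y := by
        refine Isometry.of_dist_eq fun s t => ?_
        rw [dist_add_right, dist_eq_norm, ← sub_smul, norm_smul, he, mul_one, dist_eq_norm]
      exact hiso.isClosedEmbedding.isClosed_range
  have hzero : ∃ η > 0, ∀ t : ℝ, h (t • e + y) ≠ 0 → η ≤ |ρ (t • e + y)| := by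
    rcases (tsupport h ∩ range fun t : ℝ => t • e + y).eq_empty_or_nonempty with hem | hne
    · refine ⟨1, one_pos, fun t ht => ?_⟩
      exact absurd ⟨subset_tsupport h ht, t, rfl⟩
        (eq_empty_iff_forall_notMem.1 hem (t • e + y))
    · obtain ⟨x, ⟨hx, t, rfl⟩, hmin⟩ := hcomp.exists_isMinOn hne hρ.abs.continuousOn
      refine ⟨_, abs_pos.2 (hy t (hhR hx)), fun s hs => hmin ⟨subset_tsupport h hs, s, rfl⟩⟩
  obtain ⟨η, hη, hηh⟩ := hzero
  refine tendsto_const_nhds.congr' ?_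
  filter_upwards [Ioo_mem_nhdsGT hη] with δ hδ
  rw [eq_comm, lintegral_eq_zero_iff']
  · refine Eventually.of_forall fun t => ?_
    by_cases ht : h (t • e + y) = 0
    · simp [ht]
    · exact levelKernel_of_le (hδ.2.le.trans (hηh t ht))
  · refine AEMeasurable.congr aemeasurable_const (Eventually.of_forall fun t => ?_) (f := fun _ => 0)
    by_cases ht : h (t • e + y) = 0
    · simp [ht]
    · exact (levelKernel_of_le (hδ.2.le.trans (hηh t ht))).symm

/-- The layer integrals over the lines in the direction of `e` are uniformly bounded, because such a
line stays in the layer only for a length `O(δ)`. -/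
theorem lintegral_line_le (hflat : IsAlmostLinear ρ x₀ R a ε e) {h : E → ℝ} {C : ℝ}
    (hC : 0 ≤ C) (hhC : ∀ x, h x ≤ C) (hhR : ∀ x, h x ≠ 0 → x ∈ Metric.ball x₀ R)
    (y : (ℝ ∙ e)ᗮ) {δ : ℝ} (hδ : 0 < δ) :
    ∫⁻ t : ℝ, levelKernel δ (ρ (t • e + (y : E))) (h (t • e + (y : E))) ≤
      (Metric.ball (hyperplaneProj e x₀) R).indicator
        (fun _ => ENNReal.ofReal (C / (a * (1 - ε)))) y := by
  have hc : 0 < a * (1 - ε) := mul_pos hflat.pos (sub_pos.2 hflat.lt_one)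
  set B : Set ℝ := {t | t • e + (y : E) ∈ Metric.ball x₀ R ∧ |ρ (t • e + (y : E))| < δ} with hB
  -- passing to the measurable hull of `B` makes a proof of its measurability unnecessary
  have hle : ∀ t : ℝ, levelKernel δ (ρ (t • e + (y : E))) (h (t • e + (y : E))) ≤
      (toMeasurable volume B).indicator (fun _ => ENNReal.ofReal ((2 * δ)⁻¹ * C)) t := by
    intro t
    by_cases ht : t ∈ B
    · rw [indicator_of_mem (subset_toMeasurable _ _ ht)]
      exact levelKernel_le hδ (hhC _)
    · have : levelKernel δ (ρ (t • e + (y : E))) (h (t • e + (y : E))) = 0 := by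
        by_contra hne
        refine ht ⟨hhR _ fun h0 => hne (by simp [h0]), ?_⟩
        by_contra! h0
        exact hne (levelKernel_of_le h0)
      rw [this]
      exact zero_le
  by_cases hy : y ∈ Metric.ball (hyperplaneProj e x₀) R
  · rw [indicator_of_mem hy]
    have hdiam : volume B ≤ ENNReal.ofReal (2 * δ / (a * (1 - ε))) := by
      refine (Real.volume_le_diam B).trans (Metric.ediam_le fun s hs t ht => ?_)
      rw [edist_dist, Real.dist_eq]
      refine ENNReal.ofReal_le_ofReal ?_
      rw [le_div_iff₀' hc]
      refine (hflat.le_abs_sub_of_line hs.1 ht.1).trans ?_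
      have := abs_sub (ρ (s • e + (y : E))) (ρ (t • e + (y : E)))
      linarith [hs.2, ht.2]
    calc _ ≤ ∫⁻ t, (toMeasurable volume B).indicator
          (fun _ => ENNReal.ofReal ((2 * δ)⁻¹ * C)) t := lintegral_mono hle
      _ = ENNReal.ofReal ((2 * δ)⁻¹ * C) * volume B := by
          rw [lintegral_indicator (measurableSet_toMeasurable _ _), setLIntegral_const,
            measure_toMeasurable]
      _ ≤ ENNReal.ofReal ((2 * δ)⁻¹ * C) * ENNReal.ofReal (2 * δ / (a * (1 - ε))) := by gcongr
      _ = _ := by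
          rw [← ENNReal.ofReal_mul (by positivity)]
          congr 1
          field_simp
  · have hBe : B = ∅ := by
      refine eq_empty_iff_forall_notMem.2 fun t ht => hy ?_
      have h1 := norm_hyperplaneProj_le e (t • e + (y : E) - x₀)
      rw [map_sub, hyperplaneProj_smul_add] at h1
      rw [Metric.mem_ball, dist_eq_norm]
      exact h1.trans_lt (by simpa [dist_eq_norm] using ht.1)
    have h0 : ∀ t : ℝ, levelKernel δ (ρ (t • e + (y : E))) (h (t • e + (y : E))) = 0 := by
      intro t
      by_contra hne
      have : t ∈ B := by
        refine ⟨hhR _ fun h0 => hne (by simp [h0]), ?_⟩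
        by_contra! h0
        exact hne (levelKernel_of_le h0)
      simp [hBe] at this
    simp [h0]

theorem injective_proj (hflat : IsAlmostLinear ρ x₀ R a ε e) :
    Function.Injective
      fun z : (Metric.ball x₀ R ∩ ρ ⁻¹' {0} : Set E) => hyperplaneProj e (z : E) := by
  intro z z' hzz
  have h1 := hflat.norm_sub_le z.2.1 z'.2.1 (z.2.2.trans z'.2.2.symm)
  simp only at hzz
  rw [hzz, sub_self, norm_zero, mul_zero] at h1
  exact Subtype.ext (sub_eq_zero.1 (norm_le_zero_iff.1 h1))

variable [MeasurableSpace E] [BorelSpace E]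

theorem measurableEmbedding_proj (hflat : IsAlmostLinear ρ x₀ R a ε e) (hρ : Continuous ρ) :
    MeasurableEmbedding
      fun z : (Metric.ball x₀ R ∩ ρ ⁻¹' {0} : Set E) => hyperplaneProj e (z : E) := by
  have := (measurableSet_ball_inter_levelSet (x₀ := x₀) (R := R) hρ).standardBorel
  exact Measurable.measurableEmbedding
    ((hyperplaneProj e).continuous.measurable.comp measurable_subtype_coe) hflat.injective_proj

/-- The layer integrals over a small ball converge to an integral over the projection of the level
set to the hyperplane, by dominated convergence on the lines orthogonal to it. -/
theorem tendsto_lintegral_levelKernel (hflat : IsAlmostLinear ρ x₀ R a ε e) (hρ : ContDiff ℝ 1 ρ)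
    {h : E → ℝ} (hh : Continuous h) (hh0 : ∀ x, 0 ≤ h x) (hhR : tsupport h ⊆ Metric.ball x₀ R) :
    Tendsto (fun δ => ∫⁻ x, levelKernel δ (ρ x) (h x)) (𝓝[>] 0)
      (𝓝 (∫⁻ z : (Metric.ball x₀ R ∩ ρ ⁻¹' {0} : Set E),
        ENNReal.ofReal (h z / |inner ℝ (∇ ρ z) e|)
          ∂(volume.comap fun z : (Metric.ball x₀ R ∩ ρ ⁻¹' {0} : Set E) =>
            hyperplaneProj e (z : E)))) := by
  classical
  have hhR' : ∀ x, h x ≠ 0 → x ∈ Metric.ball x₀ R := fun x hx => hhR (subset_tsupport h hx)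
  obtain ⟨C, hC⟩ : ∃ C, ∀ x, h x ≤ C := by
    obtain ⟨C, hC⟩ := hh.bounded_above_of_compact_support
      (Metric.isCompact_of_isClosed_isBounded (isClosed_tsupport h)
        (Metric.isBounded_ball.subset hhR))
    exact ⟨C, fun x => (le_abs_self _).trans (hC x)⟩
  have hC0 : 0 ≤ C := (hh0 x₀).trans (hC x₀)
  set g := fun z : (Metric.ball x₀ R ∩ ρ ⁻¹' {0} : Set E) => hyperplaneProj e (z : E) with hg
  have hgemb : MeasurableEmbedding g := hflat.measurableEmbedding_proj hρ.continuous
  -- the limit on the line through `y`, which is zero where the line misses the level set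
  set Λ : (ℝ ∙ e)ᗮ → ℝ≥0∞ := Function.extend g
    (fun z => ENNReal.ofReal (h z / |inner ℝ (∇ ρ (z : E)) e|)) 0 with hΛ
  have hlim : ∀ y : (ℝ ∙ e)ᗮ, Tendsto (fun δ => ∫⁻ t : ℝ,
      levelKernel δ (ρ (t • e + (y : E))) (h (t • e + (y : E)))) (𝓝[>] 0) (𝓝 (Λ y)) := by
    intro y
    by_cases hy : ∃ z, g z = y
    · obtain ⟨z, rfl⟩ := hy
      rw [hΛ, hflat.injective_proj.extend_apply]
      exact hflat.tendsto_line hρ hh hh0 hC hhR' z.2.1 z.2.2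
    · rw [hΛ, Function.extend_apply' _ _ _ hy]
      refine tendsto_line_of_notMem hρ.continuous hhR hflat.norm_eq fun t ht ht0 => hy ?_
      exact ⟨⟨_, ht, ht0⟩, hyperplaneProj_smul_add e t y⟩
  have hmeas : ∀ δ, Measurable fun x => levelKernel δ (ρ x) (h x) := fun δ =>
    measurable_levelKernel hρ.continuous.measurable hh.measurable δ
  have key : Tendsto (fun δ => ∫⁻ y : (ℝ ∙ e)ᗮ, ∫⁻ t : ℝ,
      levelKernel δ (ρ (t • e + (y : E))) (h (t • e + (y : E)))) (𝓝[>] 0)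
      (𝓝 (∫⁻ y, Λ y)) := by
    refine tendsto_lintegral_filter_of_dominated_convergence
      ((Metric.ball (hyperplaneProj e x₀) R).indicator
        fun _ => ENNReal.ofReal (C / (a * (1 - ε)))) ?_ ?_ ?_ (Eventually.of_forall hlim)
    · refine Eventually.of_forall fun δ => Measurable.lintegral_prod_right'
        (f := fun p : (ℝ ∙ e)ᗮ × ℝ => levelKernel δ (ρ (p.2 • e + (p.1 : E))) (h (p.2 • e + (p.1 : E)))) ?_
      exact (hmeas δ).comp (by fun_prop)
    · filter_upwards [self_mem_nhdsWithin] with δ hδ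
      exact Eventually.of_forall fun y => hflat.lintegral_line_le hC0 hC hhR' y hδ
    · rw [lintegral_indicator measurableSet_ball, setLIntegral_const]
      exact ENNReal.mul_ne_top ENNReal.ofReal_ne_top measure_ball_lt_top.ne
  have hval : ∫⁻ y, Λ y = ∫⁻ z, ENNReal.ofReal (h z / |inner ℝ (∇ ρ (z : E)) e|)
      ∂(volume.comap g) := by
    have h1 : ∀ z : (Metric.ball x₀ R ∩ ρ ⁻¹' {0} : Set E),
        ENNReal.ofReal (h z / |inner ℝ (∇ ρ (z : E)) e|) = Λ (g z) := fun z => by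
      rw [hΛ, hflat.injective_proj.extend_apply]
    simp_rw [h1]
    rw [← hgemb.lintegral_map, hgemb.map_comap, ← lintegral_indicator hgemb.measurableSet_range]
    refine lintegral_congr fun y => ?_
    by_cases hy : y ∈ range g
    · rw [indicator_of_mem hy]
    · rw [indicator_of_notMem hy, hΛ, Function.extend_apply' _ _ _ hy]
      rfl
  rw [hval] at key
  refine key.congr fun δ => ?_
  rw [lintegral_eq_lintegral_lintegral_line hflat.norm_eq (hmeas δ)]

end IsAlmostLinear

section SurfaceMeasure

open Measure

theorem setLIntegral_euclideanHausdorffMeasure {X : Type*} [EMetricSpace X] [MeasurableSpace X]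
    [BorelSpace X] {n : ℕ} {Z : Set X} (hZ : MeasurableSet Z) (Φ : X → ℝ≥0∞) :
    ∫⁻ x in Z, Φ x ∂μHE[n] = ∫⁻ z : Z, Φ z ∂μHE[n] := by
  rw [← lintegral_subtype_comap hZ]
  congr 1
  ext A hA
  rw [(MeasurableEmbedding.subtype_coe hZ).comap_apply,
    isometry_subtype_coe.euclideanHausdorffMeasure_image]

variable {E : Type*} [NormedAddCommGroup E] [InnerProductSpace ℝ E]
  {ρ : E → ℝ} {x₀ e : E} {R a ε : ℝ} {n : ℕ}

theorem IsAlmostLinear.lipschitzWith_proj :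
    LipschitzWith 1 fun z : (Metric.ball x₀ R ∩ ρ ⁻¹' {0} : Set E) => hyperplaneProj e (z : E) :=
  LipschitzWith.of_dist_le_mul fun z z' => by
    rw [dist_eq_norm, ← map_sub, NNReal.coe_one, one_mul, Subtype.dist_eq, dist_eq_norm]
    exact norm_hyperplaneProj_le _ _

variable [FiniteDimensional ℝ E]

theorem IsAlmostLinear.antilipschitzWith_proj (hflat : IsAlmostLinear ρ x₀ R a ε e) :
    AntilipschitzWith (1 - ε)⁻¹.toNNReal
      fun z : (Metric.ball x₀ R ∩ ρ ⁻¹' {0} : Set E) => hyperplaneProj e (z : E) :=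
  AntilipschitzWith.of_le_mul_dist fun z z' => by
    have := sub_pos.2 hflat.lt_one
    rw [Real.coe_toNNReal _ (by positivity), Subtype.dist_eq, dist_eq_norm, dist_eq_norm]
    exact hflat.norm_sub_le z.2.1 z'.2.1 (z.2.2.trans z'.2.2.symm)

variable [MeasurableSpace E] [BorelSpace E]

/-- On the hyperplane orthogonal to `e`, the Hausdorff measure is normalized to be the volume. -/
theorem volume_hyperplane_eq (hn : Module.finrank ℝ E = n + 1) (he : e ≠ 0) :
    (volume : Measure (ℝ ∙ e)ᗮ) = μHE[n] := by
  have : Fact (Module.finrank ℝ E = n + 1) := ⟨hn⟩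
  rw [← InnerProductSpace.euclideanHausdorffMeasure_eq_volume,
    Submodule.finrank_orthogonal_span_singleton (n := n) he]

/-- Near a regular point, the layer integrals of `ρ` converge to the surface integral of
`h / ‖∇ρ‖` up to a factor that is as close to `1` as desired: the level set is almost flat there, so
that the projection to its tangent hyperplane almost preserves the surface measure. -/
theorem exists_ball_tendsto_lintegral_levelKernel (hn : Module.finrank ℝ E = n + 1)
    (hρ : ContDiff ℝ 1 ρ) (hx₀ : ∇ ρ x₀ ≠ 0) {W : Set E} (hW : W ∈ 𝓝 x₀) {c : ℝ} (hc : 1 < c) :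
    ∃ R > 0, Metric.ball x₀ R ⊆ W ∧ μHE[n] (Metric.ball x₀ R ∩ ρ ⁻¹' {0}) < ∞ ∧
      ∀ h : E → ℝ, Continuous h → (∀ x, 0 ≤ h x) → tsupport h ⊆ Metric.ball x₀ R →
        ∃ L, Tendsto (fun δ => ∫⁻ x, levelKernel δ (ρ x) (h x)) (𝓝[>] 0) (𝓝 L) ∧
          L ≤ ENNReal.ofReal c * ∫⁻ x in Metric.ball x₀ R ∩ ρ ⁻¹' {0},
            ENNReal.ofReal (h x / ‖∇ ρ x‖) ∂μHE[n] ∧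
          ∫⁻ x in Metric.ball x₀ R ∩ ρ ⁻¹' {0}, ENNReal.ofReal (h x / ‖∇ ρ x‖) ∂μHE[n] ≤
            ENNReal.ofReal c * L := by
  obtain ⟨ε, hε, hε1, hεc⟩ : ∃ ε : ℝ, 0 < ε ∧ ε < 1 ∧
      (1 - ε)⁻¹ ^ n * ((1 + ε) / (1 - ε)) < c := by
    have h1 : Tendsto (fun ε : ℝ => (1 - ε)⁻¹ ^ n * ((1 + ε) / (1 - ε))) (𝓝 0)
        (𝓝 ((1 - 0)⁻¹ ^ n * ((1 + 0) / (1 - 0)))) := by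
      refine ContinuousAt.tendsto (f := fun ε : ℝ => (1 - ε)⁻¹ ^ n * ((1 + ε) / (1 - ε))) ?_
      have : (1 : ℝ) - 0 ≠ 0 := by norm_num
      fun_prop (disch := assumption)
    have h2 := (h1.mono_left (nhdsWithin_le_nhds (s := Ioi 0))).eventually_lt_const
      (show _ < c by simpa using hc)
    obtain ⟨ε, h3, h4⟩ := (h2.and (Ioo_mem_nhdsGT one_pos)).exists
    exact ⟨ε, h4.1, h4.2, h3⟩
  have hε' := sub_pos.2 hε1
  obtain ⟨R, hR, a, e, hRW, hflat⟩ := exists_isAlmostLinear hρ hx₀ hW hε hε1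
  have he0 : e ≠ 0 := norm_ne_zero_iff.1 (by rw [hflat.norm_eq]; exact one_ne_zero)
  set Z : Set E := Metric.ball x₀ R ∩ ρ ⁻¹' {0} with hZ
  have hZm : MeasurableSet Z := measurableSet_ball_inter_levelSet hρ.continuous
  set g := fun z : Z => hyperplaneProj e (z : E) with hg
  have hgemb : MeasurableEmbedding g := hflat.measurableEmbedding_proj hρ.continuous
  -- the projection has Lipschitz constant `1` and its inverse `(1 - ε)⁻¹`, which compares the volume
  -- of the projection with the surface measure
  set τ : Measure Z := volume.comap g with hτ
  have hτ1 : τ ≤ μHE[n] := by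
    refine le_iff.2 fun A _ => ?_
    rw [hτ, hgemb.comap_apply, volume_hyperplane_eq hn he0]
    simpa using (IsAlmostLinear.lipschitzWith_proj (ρ := ρ) (x₀ := x₀) (R := R) (e := e)
      ).euclideanHausdorffMeasure_image_le n A
  have hτ2 : (μHE[n] : Measure Z) ≤ ENNReal.ofReal ((1 - ε)⁻¹ ^ n) • τ := by
    refine le_iff.2 fun A _ => ?_
    rw [Measure.smul_apply, hτ, hgemb.comap_apply, volume_hyperplane_eq hn he0,
      ENNReal.ofReal_pow (by positivity), smul_eq_mul]
    exact hflat.antilipschitzWith_proj.le_euclideanHausdorffMeasure_image n A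
  -- the two gradients in the limit differ by a factor at most `(1 + ε) / (1 - ε)`
  have hratio : ∀ z : Z, (1 - ε) * a ≤ |inner ℝ (∇ ρ (z : E)) e| ∧
      |inner ℝ (∇ ρ (z : E)) e| ≤ (1 + ε) * a ∧ (1 - ε) * a ≤ ‖∇ ρ (z : E)‖ ∧
      ‖∇ ρ (z : E)‖ ≤ (1 + ε) * a := by
    intro z
    have h1 := abs_le.1 (hflat.abs_inner_gradient_sub_le z.2.1)
    have h2 := abs_le.1 (hflat.abs_norm_gradient_sub_le z.2.1)
    have h3 := le_abs_self (inner ℝ (∇ ρ (z : E)) e : ℝ)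
    refine ⟨by linarith, ?_, by linarith, by linarith⟩
    rw [abs_of_nonneg] <;> nlinarith [mul_pos hε' hflat.pos]
  have hdiv : ∀ u v w : ℝ, 0 ≤ u → (1 - ε) * a ≤ v → w ≤ (1 + ε) * a → 0 < w →
      ENNReal.ofReal (u / v) ≤ ENNReal.ofReal ((1 + ε) / (1 - ε)) * ENNReal.ofReal (u / w) := by
    intro u v w hu hv hw hw0
    have hv0 := (mul_pos hε' hflat.pos).trans_le hv
    have ha := hflat.pos
    rw [← ENNReal.ofReal_mul (by positivity)]
    refine ENNReal.ofReal_le_ofReal ?_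
    rw [div_mul_div_comm, div_le_div_iff₀ hv0 (by positivity)]
    have h1 : (1 - ε) * w ≤ (1 + ε) * v := by
      calc (1 - ε) * w ≤ (1 - ε) * ((1 + ε) * a) := by gcongr
        _ = (1 + ε) * ((1 - ε) * a) := by ring
        _ ≤ _ := by gcongr
    nlinarith
  refine ⟨R, hR, hRW, ?_, fun h hh hh0 hhR => ⟨_, hflat.tendsto_lintegral_levelKernel hρ hh hh0 hhR,
    ?_, ?_⟩⟩
  · have h1 : μHE[n] Z = μHE[n] (univ : Set Z) := by
      rw [← (isometry_subtype_coe (s := Z)).euclideanHausdorffMeasure_image, image_univ,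
        Subtype.range_coe]
    rw [h1]
    refine (hτ2 univ).trans_lt ?_
    rw [Measure.smul_apply, hτ, hgemb.comap_apply, smul_eq_mul]
    refine ENNReal.mul_lt_top ENNReal.ofReal_lt_top
      ((measure_mono ?_).trans_lt (measure_ball_lt_top (x := hyperplaneProj e x₀) (r := R)))
    rintro _ ⟨z, -, rfl⟩
    rw [Metric.mem_ball, dist_eq_norm, hg, ← map_sub]
    refine (norm_hyperplaneProj_le _ _).trans_lt ?_
    simpa [dist_eq_norm] using z.2.1
  · rw [setLIntegral_euclideanHausdorffMeasure hZm]
    calc _ ≤ ∫⁻ z : Z, ENNReal.ofReal ((1 + ε) / (1 - ε)) *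
          ENNReal.ofReal (h z / ‖∇ ρ (z : E)‖) ∂μHE[n] := by
          refine lintegral_mono' hτ1 fun z => hdiv _ _ _ (hh0 _) (hratio z).1 (hratio z).2.2.2 ?_
          exact (mul_pos hε' hflat.pos).trans_le (hratio z).2.2.1
      _ = ENNReal.ofReal ((1 + ε) / (1 - ε)) * ∫⁻ z : Z,
          ENNReal.ofReal (h z / ‖∇ ρ (z : E)‖) ∂μHE[n] :=
          lintegral_const_mul' _ _ ENNReal.ofReal_ne_top
      _ ≤ _ := by
          gcongr
          refine le_trans ?_ hεc.le
          refine le_mul_of_one_le_left (by positivity) (one_le_pow₀ ?_)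
          exact (one_le_inv₀ hε').2 (by linarith)
  · rw [setLIntegral_euclideanHausdorffMeasure hZm]
    calc _ ≤ ∫⁻ z : Z, ENNReal.ofReal ((1 + ε) / (1 - ε)) *
          ENNReal.ofReal (h z / |inner ℝ (∇ ρ (z : E)) e|)
            ∂(ENNReal.ofReal ((1 - ε)⁻¹ ^ n) • τ) := by
          refine lintegral_mono' hτ2 fun z => hdiv _ _ _ (hh0 _) (hratio z).2.2.1 (hratio z).2.1 ?_
          exact (mul_pos hε' hflat.pos).trans_le (hratio z).1
      _ = ENNReal.ofReal ((1 - ε)⁻¹ ^ n * ((1 + ε) / (1 - ε))) * ∫⁻ z : Z,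
          ENNReal.ofReal (h z / |inner ℝ (∇ ρ (z : E)) e|) ∂τ := by
          rw [lintegral_smul_measure, lintegral_const_mul' _ _ ENNReal.ofReal_ne_top,
            ENNReal.ofReal_mul (by positivity), smul_eq_mul, mul_assoc]
      _ ≤ _ := by gcongr

end SurfaceMeasure

/-! ### The paths of the process -/

section Path

variable {d : ℕ} {Ω : Type*} {U S D : Set (EuclideanSpace ℝ (Fin d))}
  {r : EuclideanSpace ℝ (Fin d) → EuclideanSpace ℝ (Fin d)}
  {φ : EuclideanSpace ℝ (Fin d) → ℝ → EuclideanSpace ℝ (Fin d)}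
  {ρ : EuclideanSpace ℝ (Fin d) → ℝ} {T : ℕ → Ω → ℝ} {M : ℕ → Ω → EuclideanSpace ℝ (Fin d)}
  {ω : Ω}

theorem IsDefiningFunction.mem_iff (hρ : IsDefiningFunction U D ρ) (hDopen : IsOpen D)
    {x : EuclideanSpace ℝ (Fin d)} : x ∈ U ∩ frontier D ↔ x ∈ U ∧ ρ x = 0 := by
  refine and_congr_right fun hx => ?_
  have hneg : x ∈ D ↔ ρ x < 0 := by rw [hρ.neg]; simp [hx]
  have hpos : x ∉ closure D ↔ 0 < ρ x := by
    have : x ∈ U \ closure D ↔ 0 < ρ x := by rw [hρ.pos]; simp [hx]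
    rw [← this]; simp [hx]
  rw [hDopen.frontier_eq, Set.mem_sdiff, hneg, ← not_not (a := x ∈ closure D), hpos]
  constructor
  · rintro ⟨h1, h2⟩; linarith
  · intro h; simp [h]

/-- The derivative of `ρ` along the vector field `r`. -/
noncomputable def normalSpeed (ρ : EuclideanSpace ℝ (Fin d) → ℝ)
    (r : EuclideanSpace ℝ (Fin d) → EuclideanSpace ℝ (Fin d)) (x : EuclideanSpace ℝ (Fin d)) : ℝ :=
  inner ℝ (∇ ρ x) (r x)

theorem continuous_gradient (hρ : ContDiff ℝ 1 ρ) : Continuous (∇ ρ) :=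
  (InnerProductSpace.toDual ℝ _).symm.continuous.comp (hρ.continuous_fderiv one_ne_zero)

theorem continuousOn_normalSpeed (hρ : ContDiff ℝ 1 ρ) (hr : ContDiffOn ℝ 1 r U) :
    ContinuousOn (normalSpeed ρ r) U :=
  (continuous_gradient hρ).continuousOn.inner hr.continuousOn

theorem IsGlobalFlow.hasDerivAt_comp (hφ : IsGlobalFlow U r φ) (hρ : ContDiff ℝ 1 ρ)
    {ζ : EuclideanSpace ℝ (Fin d)} (hζ : ζ ∈ U) (a t : ℝ) :
    HasDerivAt (fun s => ρ (φ ζ (s - a))) (normalSpeed ρ r (φ ζ (t - a))) t := by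
  rw [normalSpeed, inner_gradient_left]
  have h1 : HasFDerivAt ρ (fderiv ℝ ρ (φ ζ (t - a))) (φ ζ (t - a)) :=
    (hρ.differentiable one_ne_zero _).hasFDerivAt
  exact h1.comp_hasDerivAt t (HasDerivAt.comp_sub_const t a (hφ.hasDerivAt ζ hζ (t - a)))

/-- The flow leaves `S` at once, in both time directions. -/
theorem IsGlobalFlow.eventually_notMem (hφ : IsGlobalFlow U r φ) (hρ : ContDiff ℝ 1 ρ)
    (hS : ∀ x, x ∈ S ↔ x ∈ U ∧ ρ x = 0) (hg : ∀ x ∈ S, normalSpeed ρ r x ≠ 0)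
    {ζ : EuclideanSpace ℝ (Fin d)} (hζ : ζ ∈ U) {a t : ℝ} (ht : φ ζ (t - a) ∈ S) :
    ∀ᶠ s in 𝓝[≠] t, φ ζ (s - a) ∉ S := by
  have h1 := (hφ.hasDerivAt_comp hρ hζ a t).eventually_ne (c := 0) (hg _ ht)
  filter_upwards [h1] with s hs hsS
  exact hs ((hS _).1 hsS).2

/-- The jump times start at `0`, increase, and do not accumulate. -/
structure IsGoodPath (T : ℕ → Ω → ℝ) (ω : Ω) : Prop where
  zero : T 0 ω = 0
  mono : Monotone fun n => T n ω
  tendsto : Tendsto (fun n => T n ω) atTop atTop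

theorem IsMarkedPointProcess.ae_isGoodPath [MeasurableSpace Ω] {P : Measure Ω}
    (h : IsMarkedPointProcess P U T M) : ∀ᵐ ω ∂P, IsGoodPath T ω := by
  filter_upwards [h.time_zero, h.time_mono, h.time_tendsto] with ω h0 h1 h2
  exact ⟨h0, monotone_nat_of_le_succ h1, h2⟩

namespace IsGoodPath

theorem lastJump_eq (h : IsGoodPath T ω) {n : ℕ} {s : ℝ} (h1 : T n ω ≤ s) (h2 : s < T (n + 1) ω) :
    lastJump T s ω = n := by
  have : {k | T k ω ≤ s} = Iic n := by
    ext k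
    simp only [mem_ofPred_eq, mem_Iic]
    refine ⟨fun hk => ?_, fun hk => (h.mono hk).trans h1⟩
    by_contra! hnk
    exact absurd (h.mono (Nat.succ_le_of_lt hnk)) (not_le.2 (hk.trans_lt h2))
  rw [lastJump, this, csSup_Iic]

theorem psp_eq (h : IsGoodPath T ω) {n : ℕ} {s : ℝ} (h1 : T n ω ≤ s) (h2 : s < T (n + 1) ω) :
    psp φ T M s ω = φ (M n ω) (s - T n ω) := by
  rw [psp, h.lastJump_eq h1 h2]

/-- Every time `s ≥ 0` belongs to a smooth piece `[T n, T (n + 1))`. -/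
theorem exists_le_lt (h : IsGoodPath T ω) {s : ℝ} (hs : 0 ≤ s) :
    ∃ n, T n ω ≤ s ∧ s < T (n + 1) ω := by
  classical
  have hex : ∃ n, s < T n ω := (h.tendsto.eventually_gt_atTop s).exists
  have hne : Nat.find hex ≠ 0 := fun h0 => by
    have := Nat.find_spec hex
    rw [h0, h.zero] at this
    exact this.not_ge hs
  obtain ⟨n, hn⟩ := Nat.exists_eq_succ_of_ne_zero hne
  refine ⟨n, not_lt.1 (Nat.find_min hex (by omega)), ?_⟩
  have := Nat.find_spec hex
  rwa [hn] at this

/-- Every time `s > 0` belongs to some `(T n, T (n + 1)]`, the piece that determines the left limit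
at `s`. -/
theorem exists_lt_le (h : IsGoodPath T ω) {s : ℝ} (hs : 0 < s) :
    ∃ n, T n ω < s ∧ s ≤ T (n + 1) ω := by
  classical
  have hex : ∃ n, s ≤ T n ω := (h.tendsto.eventually_ge_atTop s).exists
  have hne : Nat.find hex ≠ 0 := fun h0 => by
    have := Nat.find_spec hex
    rw [h0, h.zero] at this
    exact this.not_gt hs
  obtain ⟨n, hn⟩ := Nat.exists_eq_succ_of_ne_zero hne
  refine ⟨n, not_le.1 (Nat.find_min hex (by omega)), ?_⟩
  have := Nat.find_spec hex
  rwa [hn] at this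

theorem tendsto_psp_left (h : IsGoodPath T ω) (hφ : IsGlobalFlow U r φ) (hM : ∀ n, M n ω ∈ U)
    {n : ℕ} {s : ℝ} (h1 : T n ω < s) (h2 : s ≤ T (n + 1) ω) :
    Tendsto (fun t => psp φ T M t ω) (𝓝[<] s) (𝓝 (φ (M n ω) (s - T n ω))) := by
  have hc : Continuous fun t => φ (M n ω) (t - T n ω) :=
    (hφ.continuous (hM n)).comp (by fun_prop)
  refine (hc.continuousAt.mono_left nhdsWithin_le_nhds).congr' ?_
  filter_upwards [Ioo_mem_nhdsLT h1] with t ht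
  exact (h.psp_eq ht.1.le (ht.2.trans_le h2)).symm

variable {H : ℝ}

/-- In the absence of jumps from or to `S`, the left limit of a path is in `S` if and only if the
value is. -/
theorem mem_iff_left_mem (h : IsGoodPath T ω) (hφ : IsGlobalFlow U r φ) (hM : ∀ n, M n ω ∈ U)
    (hnj : NoJumpFromOrTo S (fun t => psp φ T M t ω) H) {n : ℕ} {s : ℝ} (hsH : s ≤ H)
    (hs : 0 < s) (h1 : T n ω < s) (h2 : s ≤ T (n + 1) ω) :
    psp φ T M s ω ∈ S ↔ φ (M n ω) (s - T n ω) ∈ S := by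
  by_cases heq : φ (M n ω) (s - T n ω) = psp φ T M s ω
  · rw [heq]
  · have := hnj s ⟨hs, hsH⟩ _ (h.tendsto_psp_left hφ hM h1 h2) heq
    exact ⟨fun h => absurd h this.2, fun h => absurd h this.1⟩

theorem psp_mem (h : IsGoodPath T ω) (hφ : IsGlobalFlow U r φ) (hM : ∀ n, M n ω ∈ U)
    {s : ℝ} (hs : 0 ≤ s) : psp φ T M s ω ∈ U := by
  obtain ⟨n, h1, h2⟩ := h.exists_le_lt hs
  rw [h.psp_eq h1 h2]
  exact hφ.mem _ (hM n) _

/-- Without jumps from or to `S`, the continuous crossings in `[0, H]` are the times in `(0, H]` at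
which the path is in `S`. -/
theorem setOf_isContinuousCrossing (h : IsGoodPath T ω) (hφ : IsGlobalFlow U r φ)
    (hρ : ContDiff ℝ 1 ρ) (hS : ∀ x, x ∈ S ↔ x ∈ U ∧ ρ x = 0)
    (hg : ∀ x ∈ S, normalSpeed ρ r x ≠ 0) (hM : ∀ n, M n ω ∈ U)
    (hnj : NoJumpFromOrTo S (fun t => psp φ T M t ω) H) :
    {s | s ∈ Icc 0 H ∧ IsContinuousCrossing S (fun t => psp φ T M t ω) s} =
      {s | ρ (psp φ T M s ω) = 0} ∩ Ioc 0 H := by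
  ext s
  constructor
  · rintro ⟨hsH, h0, -, hsS, -⟩
    exact ⟨((hS _).1 hsS).2, h0, hsH.2⟩
  · rintro ⟨hs0, hs, hsH⟩
    have hsS : psp φ T M s ω ∈ S := (hS _).2 ⟨h.psp_mem hφ hM hs.le, hs0⟩
    obtain ⟨n, hn1, hn2⟩ := h.exists_lt_le hs
    obtain ⟨m, hm1, hm2⟩ := h.exists_le_lt hs.le
    have hleft := h.tendsto_psp_left hφ hM hn1 hn2
    have hnS := (h.mem_iff_left_mem hφ hM hnj hsH hs hn1 hn2).1 hsS
    have heq : φ (M n ω) (s - T n ω) = psp φ T M s ω := by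
      by_contra hne
      exact (hnj s ⟨hs, hsH⟩ _ hleft hne).2 hsS
    have hmS : φ (M m ω) (s - T m ω) ∈ S := by
      rwa [← h.psp_eq (φ := φ) (M := M) hm1 hm2]
    have e1 : ∀ᶠ t in 𝓝[<] s, psp φ T M t ω ∉ S := by
      have := (hφ.eventually_notMem hρ hS hg (hM n) hnS).filter_mono
        (nhdsWithin_mono s (fun t (ht : t < s) => ht.ne))
      filter_upwards [this, Ioo_mem_nhdsLT hn1] with t ht ht'
      rwa [h.psp_eq ht'.1.le (ht'.2.trans_le hn2)]
    have e2 : ∀ᶠ t in 𝓝[>] s, psp φ T M t ω ∉ S := by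
      have := (hφ.eventually_notMem hρ hS hg (hM m) hmS).filter_mono
        (nhdsWithin_mono s (fun t (ht : s < t) => ht.ne'))
      filter_upwards [this, Ioo_mem_nhdsGT hm2] with t ht ht'
      rwa [h.psp_eq (hm1.trans ht'.1.le) ht'.2]
    have e3 : ∀ᶠ t in 𝓝[≠] s, psp φ T M t ω ∉ S := by
      rw [← Iio_union_Ioi, nhdsWithin_union]
      exact eventually_sup.2 ⟨e1, e2⟩
    rw [eventually_nhdsWithin_iff] at e3
    obtain ⟨δ, hδ, hball⟩ := Metric.eventually_nhds_iff.1 e3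
    rw [heq] at hleft
    refine ⟨⟨hs.le, hsH⟩, hs, hleft, hsS, δ, hδ, fun t ht => hball ?_ ht.2⟩
    rw [Real.dist_eq, abs_lt]
    exact ⟨by linarith [ht.1.1], by linarith [ht.1.2]⟩

/-- On a smooth piece the path follows the flow, whose zeros are simple. At the end of the piece the
path may jump, but not from or to `S`, so that the zeros of the path are those of the flow. -/
theorem approximatesHalfCount_piece (h : IsGoodPath T ω) (hφ : IsGlobalFlow U r φ)
    (hρ : ContDiff ℝ 1 ρ) (hS : ∀ x, x ∈ S ↔ x ∈ U ∧ ρ x = 0)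
    (hg : ∀ x ∈ S, normalSpeed ρ r x ≠ 0) (hM : ∀ n, M n ω ∈ U)
    (hnj : NoJumpFromOrTo S (fun t => psp φ T M t ω) H) {G : EuclideanSpace ℝ (Fin d) → ℝ}
    (hG : Continuous G) (hGS : ∀ x ∈ S, G x = |normalSpeed ρ r x|) {n : ℕ} {b : ℝ}
    (hb : T n ω ≤ b) (hb1 : b ≤ T (n + 1) ω) (hbH : b ≤ H) :
    ApproximatesHalfCount (fun s => ρ (psp φ T M s ω)) (fun s => G (psp φ T M s ω)) (T n ω) b := by
  set γ : ℝ → EuclideanSpace ℝ (Fin d) := fun s => φ (M n ω) (s - T n ω) with hγ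
  have hγc : Continuous γ := (hφ.continuous (hM n)).comp (by fun_prop)
  have hγU : ∀ s, γ s ∈ U := fun s => hφ.mem _ (hM n) _
  have h0 : 0 ≤ T n ω := h.zero ▸ h.mono (Nat.zero_le n)
  have key : ApproximatesHalfCount (fun s => ρ (γ s)) (fun s => G (γ s)) (T n ω) b := by
    refine approximatesHalfCount_of_simple_zeros (hρ.continuous.comp hγc) (hG.comp hγc) hb
      fun t _ ht => ?_
    have htS : γ t ∈ S := (hS _).2 ⟨hγU t, ht⟩
    exact ⟨_, hg _ htS, hφ.hasDerivAt_comp hρ (hM n) _ t, hGS _ htS⟩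
  have heq : ∀ s ∈ Ico (T n ω) b, psp φ T M s ω = γ s := fun s hs =>
    h.psp_eq hs.1 (hs.2.trans_le hb1)
  have hcount : halfCount {s | ρ (γ s) = 0} (T n ω) b =
      halfCount {s | ρ (psp φ T M s ω) = 0} (T n ω) b := by
    have e1 : {s | ρ (γ s) = 0} ∩ Ico (T n ω) b = {s | ρ (psp φ T M s ω) = 0} ∩ Ico (T n ω) b := by
      ext s
      refine and_congr_left fun hs => ?_
      simp only [mem_ofPred_eq, heq s hs]
    have e2 : {s | ρ (γ s) = 0} ∩ Ioc (T n ω) b = {s | ρ (psp φ T M s ω) = 0} ∩ Ioc (T n ω) b := by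
      ext s
      refine and_congr_left fun hs => ?_
      have hs0 : 0 < s := h0.trans_lt hs.1
      have h1 := h.mem_iff_left_mem hφ hM hnj (hs.2.trans hbH) hs0 hs.1 (hs.2.trans hb1)
      rw [hS, hS] at h1
      simpa [h.psp_mem hφ hM hs0.le, hγU s, hγ, hφ.mem _ (hM n)] using h1.symm
    rw [halfCount, halfCount, e1, e2]
  rw [ApproximatesHalfCount, hcount] at key
  refine key.congr fun δ => ?_
  rw [← setLIntegral_congr Ioo_ae_eq_Ioc, ← setLIntegral_congr Ioo_ae_eq_Ioc]
  refine setLIntegral_congr_fun measurableSet_Ioo fun s hs => ?_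
  simp only [heq s (Ioo_subset_Ico_self hs)]

/-- The approximate counting integrals along a path converge to the number of continuous
crossings. -/
theorem tendsto_crossingCount (h : IsGoodPath T ω) (hφ : IsGlobalFlow U r φ)
    (hρ : ContDiff ℝ 1 ρ) (hS : ∀ x, x ∈ S ↔ x ∈ U ∧ ρ x = 0)
    (hg : ∀ x ∈ S, normalSpeed ρ r x ≠ 0) (hM : ∀ n, M n ω ∈ U) (hH : 0 ≤ H)
    (hnj : NoJumpFromOrTo S (fun t => psp φ T M t ω) H) {G : EuclideanSpace ℝ (Fin d) → ℝ}
    (hG : Continuous G) (hGS : ∀ x ∈ S, G x = |normalSpeed ρ r x|)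
    (h0 : psp φ T M 0 ω ∉ S) (hHS : psp φ T M H ω ∉ S) :
    Tendsto (fun δ => ∫⁻ s in Ioc 0 H, levelKernel δ (ρ (psp φ T M s ω)) (G (psp φ T M s ω)))
      (𝓝[>] 0) (𝓝 (crossingCount S (fun t => psp φ T M t ω) H)) := by
  have key : ∀ n, ApproximatesHalfCount (fun s => ρ (psp φ T M s ω))
      (fun s => G (psp φ T M s ω)) 0 (min (T n ω) H) := by
    intro n
    induction n with
    | zero =>
      rw [h.zero, min_eq_left hH]
      exact approximatesHalfCount_self _ _ _
    | succ n ih =>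
      rcases le_total H (T n ω) with hle | hle
      · rw [min_eq_right hle] at ih
        rwa [min_eq_right (hle.trans (h.mono (Nat.le_succ n)))]
      · rw [min_eq_left hle] at ih
        have h2 : T n ω ≤ min (T (n + 1) ω) H := le_min (h.mono (Nat.le_succ n)) hle
        exact ih.trans (h.approximatesHalfCount_piece hφ hρ hS hg hM hnj hG hGS h2
          (min_le_left _ _) (min_le_right _ _)) (h.zero ▸ h.mono (Nat.zero_le n)) h2
  obtain ⟨n, hn⟩ := (h.tendsto.eventually_ge_atTop H).exists
  have hlim := key n
  rw [min_eq_right hn] at hlim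
  have h0' : ρ (psp φ T M 0 ω) ≠ 0 := fun hz => h0 ((hS _).2 ⟨h.psp_mem hφ hM le_rfl, hz⟩)
  have hH' : ρ (psp φ T M H ω) ≠ 0 := fun hz => hHS ((hS _).2 ⟨h.psp_mem hφ hM hH, hz⟩)
  -- no crossing at the endpoints, so that both half-open intervals contain all of them
  have e : {s | ρ (psp φ T M s ω) = 0} ∩ Ico 0 H = {s | ρ (psp φ T M s ω) = 0} ∩ Ioc 0 H := by
    ext s
    refine and_congr_right fun hs => ⟨fun hs1 => ⟨hs1.1.lt_of_ne ?_, hs1.2.le⟩,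
      fun hs1 => ⟨hs1.1.le, hs1.2.lt_of_ne ?_⟩⟩
    · rintro rfl
      exact h0' hs
    · rintro rfl
      exact hH' hs
  have hc : halfCount {s | ρ (psp φ T M s ω) = 0} 0 H =
      (crossingCount S (fun t => psp φ T M t ω) H : ℝ≥0∞) := by
    rw [halfCount, e, crossingCount, h.setOf_isContinuousCrossing hφ hρ hS hg hM hnj, ← two_mul,
      ← mul_assoc, ENNReal.inv_mul_cancel two_ne_zero ENNReal.ofNat_ne_top, one_mul]
  rw [ApproximatesHalfCount, hc] at hlim
  exact hlim

end IsGoodPath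

end Path

/-! ### The dominating function -/

section Domination

variable {d : ℕ} {Ω : Type*} {U S : Set (EuclideanSpace ℝ (Fin d))}
  {r : EuclideanSpace ℝ (Fin d) → EuclideanSpace ℝ (Fin d)}
  {φ : EuclideanSpace ℝ (Fin d) → ℝ → EuclideanSpace ℝ (Fin d)}
  {ρ : EuclideanSpace ℝ (Fin d) → ℝ} {T : ℕ → Ω → ℝ} {M : ℕ → Ω → EuclideanSpace ℝ (Fin d)}
  {ω : Ω} {H : ℝ}

/-- Trajectories through a compact set on which the flow is transverse to the level sets of `ρ`
stay uniformly transverse for a uniform time. -/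
theorem IsGlobalFlow.exists_forall_le_normalSpeed (hφ : IsGlobalFlow U r φ) (hU : IsOpen U)
    (hr : ContDiffOn ℝ 1 r U) (hρ : ContDiff ℝ 1 ρ) {K : Set (EuclideanSpace ℝ (Fin d))}
    (hK : IsCompact K) (hKU : K ⊆ U) (hg : ∀ x ∈ K, normalSpeed ρ r x ≠ 0) :
    ∃ c > 0, ∃ τ > 0, ∀ x ∈ K, ∀ s : ℝ, |s| < τ → c ≤ |normalSpeed ρ r (φ x s)| := by
  have hgc := continuousOn_normalSpeed hρ hr
  obtain ⟨c, hc, hcK⟩ : ∃ c > 0, ∀ x ∈ K, c < |normalSpeed ρ r x| := by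
    rcases K.eq_empty_or_nonempty with rfl | hne
    · exact ⟨1, one_pos, by simp⟩
    · obtain ⟨x, hx, hmin⟩ := hK.exists_isMinOn hne (hgc.mono hKU).abs
      have hpos := abs_pos.2 (hg x hx)
      exact ⟨_, half_pos hpos, fun y hy => (half_lt_self hpos).trans_le (hmin hy)⟩
  have hW : IsOpen (U ∩ {x | c < |normalSpeed ρ r x|}) :=
    hgc.abs.isOpen_inter_preimage hU isOpen_Ioi
  have hV : IsOpen ((U ×ˢ univ) ∩ Function.uncurry φ ⁻¹' (U ∩ {x | c < |normalSpeed ρ r x|})) :=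
    (hφ.continuousOn hU hr).isOpen_inter_preimage (hU.prod isOpen_univ) hW
  obtain ⟨u, v, -, hv, hKu, h0v, huv⟩ := generalized_tube_lemma hK
    (isCompact_singleton (x := (0 : ℝ))) hV (by
      rintro ⟨x, s⟩ ⟨hx, hs⟩
      rw [mem_singleton_iff] at hs
      subst hs
      refine ⟨⟨hKU hx, mem_univ _⟩, ?_⟩
      simp only [mem_preimage, Function.uncurry, hφ.map_zero x (hKU hx)]
      exact ⟨hKU hx, hcK x hx⟩)
  obtain ⟨τ, hτ, hball⟩ := Metric.isOpen_iff.1 hv 0 (h0v rfl)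
  refine ⟨c, hc, τ, hτ, fun x hx s hs => ?_⟩
  have hsv : s ∈ v := hball (by simpa using hs)
  exact (huv (show (x, s) ∈ u ×ˢ v from ⟨hKu hx, hsv⟩)).2.2.le

/-- The zeros inside a smooth piece within `[0, H]` are, after a shift in time, crossings of the flow
within `[0, H]`. -/
theorem IsGlobalFlow.encard_zeros_le (hφ : IsGlobalFlow U r φ) (hρ : ContDiff ℝ 1 ρ)
    (hS : ∀ x, x ∈ S ↔ x ∈ U ∧ ρ x = 0) (hg : ∀ x ∈ S, normalSpeed ρ r x ≠ 0)
    {ζ : EuclideanSpace ℝ (Fin d)} (hζ : ζ ∈ U) {a b : ℝ} (ha : 0 ≤ a) (hb : b ≤ H) :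
    ({s | ρ (φ ζ (s - a)) = 0} ∩ Ioo a b).encard ≤ crossingCount S (φ ζ) H := by
  have hinj : Function.Injective fun s : ℝ => s - a := sub_left_injective
  rw [← hinj.encard_image]
  refine encard_le_encard ?_
  rintro _ ⟨s, ⟨hs0, hs⟩, rfl⟩
  have hsS : φ ζ (s - a) ∈ S := (hS _).2 ⟨hφ.mem _ hζ _, hs0⟩
  refine ⟨⟨by linarith [hs.1], by linarith [hs.2]⟩, sub_pos.2 hs.1,
    (hφ.continuous hζ).continuousAt.mono_left nhdsWithin_le_nhds, hsS, ?_⟩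
  have h1 := hφ.eventually_notMem hρ hS hg hζ (a := 0) (t := s - a) (by simpa using hsS)
  simp only [sub_zero] at h1
  rw [eventually_nhdsWithin_iff] at h1
  obtain ⟨δ, hδ, hball⟩ := Metric.eventually_nhds_iff.1 h1
  refine ⟨δ, hδ, fun t ht => hball ?_ ht.2⟩
  rw [Real.dist_eq, abs_lt]
  exact ⟨by linarith [ht.1.1], by linarith [ht.1.2]⟩

/-- The contribution of one smooth piece. -/
theorem IsGoodPath.lintegral_piece_le (h : IsGoodPath T ω) (hφ : IsGlobalFlow U r φ)
    (hU : IsOpen U) (hr : ContDiffOn ℝ 1 r U)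
    (hρ : ContDiff ℝ 1 ρ) (hS : ∀ x, x ∈ S ↔ x ∈ U ∧ ρ x = 0)
    (hg : ∀ x ∈ S, normalSpeed ρ r x ≠ 0) (hM : ∀ n, M n ω ∈ U)
    {G : EuclideanSpace ℝ (Fin d) → ℝ} {c τ C δ : ℝ} {N : ℕ} (hc : 0 < c)
    (hcτ : ∀ x ∈ U, G x ≠ 0 → ∀ s : ℝ, |s| < τ → c ≤ |normalSpeed ρ r (φ x s)|) (hC : 0 ≤ C)
    (hGC : ∀ x, G x ≤ C) (hN : ∀ x ∈ U, crossingCount S (φ x) H ≤ N) (hδ : 0 < δ)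
    (hδτ : δ < c * τ) {n : ℕ} {b : ℝ} (hb1 : b ≤ T (n + 1) ω) (hbH : b ≤ H) :
    ∫⁻ s in Ioc (T n ω) b, levelKernel δ (ρ (psp φ T M s ω)) (G (psp φ T M s ω)) ≤
      ENNReal.ofReal ((N + 1) * C / c) := by
  set γ : ℝ → EuclideanSpace ℝ (Fin d) := fun s => φ (M n ω) (s - T n ω) with hγ
  have hγc : Continuous γ := (hφ.continuous (hM n)).comp (by fun_prop)
  have hγU : ∀ s, γ s ∈ U := fun s => hφ.mem _ (hM n) _
  have heq : ∫⁻ s in Ioc (T n ω) b, levelKernel δ (ρ (psp φ T M s ω)) (G (psp φ T M s ω)) =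
      ∫⁻ s in Ioc (T n ω) b, levelKernel δ (ρ (γ s)) (G (γ s)) := by
    rw [← setLIntegral_congr Ioo_ae_eq_Ioc, ← setLIntegral_congr Ioo_ae_eq_Ioc]
    refine setLIntegral_congr_fun measurableSet_Ioo fun s hs => ?_
    simp only [h.psp_eq (φ := φ) (M := M) hs.1.le (hs.2.trans_le hb1), hγ]
  rw [heq]
  have h0 : 0 ≤ T n ω := h.zero ▸ h.mono (Nat.zero_le n)
  refine lintegral_levelKernel_le (f' := fun s => normalSpeed ρ r (γ s)) (τ := τ) hc hδ hδτ hC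
    (fun s => hGC _) ?_ (fun t ht s hs => ⟨hφ.hasDerivAt_comp hρ (hM n) _ s, ?_⟩)
    ((hφ.encard_zeros_le hρ hS hg (hM n) h0 hbH).trans (hN _ (hM n)))
  · exact (continuousOn_normalSpeed hρ hr).comp_continuous hγc hγU
  · have h1 := hcτ (γ t) (hγU t) ht (s - t) hs
    rwa [hγ, hφ.apply_apply hU hr (hM n), show t - T n ω + (s - t) = s - T n ω by ring] at h1

/-- The approximate counting integrals along a path are dominated by a multiple of the number of
jump times: each smooth piece contributes a bounded amount. -/
theorem IsGoodPath.lintegral_path_le (h : IsGoodPath T ω) (hφ : IsGlobalFlow U r φ)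
    (hU : IsOpen U) (hr : ContDiffOn ℝ 1 r U)
    (hρ : ContDiff ℝ 1 ρ) (hS : ∀ x, x ∈ S ↔ x ∈ U ∧ ρ x = 0)
    (hg : ∀ x ∈ S, normalSpeed ρ r x ≠ 0) (hM : ∀ n, M n ω ∈ U) (hH : 0 ≤ H)
    {G : EuclideanSpace ℝ (Fin d) → ℝ} {c τ C δ : ℝ} {N : ℕ} (hc : 0 < c)
    (hcτ : ∀ x ∈ U, G x ≠ 0 → ∀ s : ℝ, |s| < τ → c ≤ |normalSpeed ρ r (φ x s)|) (hC : 0 ≤ C)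
    (hGC : ∀ x, G x ≤ C) (hN : ∀ x ∈ U, crossingCount S (φ x) H ≤ N) (hδ : 0 < δ)
    (hδτ : δ < c * τ) :
    ∫⁻ s in Ioc 0 H, levelKernel δ (ρ (psp φ T M s ω)) (G (psp φ T M s ω)) ≤
      ENNReal.ofReal ((N + 1) * C / c) * (jumpTimes T 0 H ω).encard := by
  -- a piece is charged to the jump time at its start; pieces of length zero, which occur when jump
  -- times coincide, contribute nothing
  have key : ∀ n, ∫⁻ s in Ioc 0 (min (T n ω) H),
      levelKernel δ (ρ (psp φ T M s ω)) (G (psp φ T M s ω)) ≤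
      ENNReal.ofReal ((N + 1) * C / c) * (jumpTimes T 0 H ω ∩ Iio (min (T n ω) H)).encard := by
    intro n
    induction n with
    | zero => simp [h.zero, min_eq_left hH]
    | succ n ih =>
      have hmono : T n ω ≤ T (n + 1) ω := h.mono (Nat.le_succ n)
      rcases le_or_gt H (T n ω) with hle | hlt
      · rw [min_eq_right hle] at ih
        rwa [min_eq_right (hle.trans hmono)]
      rw [min_eq_left hlt.le] at ih
      have h0 : 0 ≤ T n ω := h.zero ▸ h.mono (Nat.zero_le n)
      have h2 : T n ω ≤ min (T (n + 1) ω) H := le_min hmono hlt.le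
      rcases h2.eq_or_lt with heq | h2lt
      · rwa [← heq]
      have hcard : (jumpTimes T 0 H ω ∩ Iio (T n ω)).encard + 1 ≤
          (jumpTimes T 0 H ω ∩ Iio (min (T (n + 1) ω) H)).encard := by
        rw [← encard_insert_of_notMem (a := T n ω) (by simp)]
        refine encard_le_encard (insert_subset ⟨⟨⟨h0, hlt.le⟩, n, rfl⟩, h2lt⟩ ?_)
        exact inter_subset_inter_right _ (Iio_subset_Iio h2)
      have hcard' : ((jumpTimes T 0 H ω ∩ Iio (T n ω)).encard : ℝ≥0∞) + 1 ≤
          ((jumpTimes T 0 H ω ∩ Iio (min (T (n + 1) ω) H)).encard : ℝ≥0∞) := by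
        rw [← ENat.toENNReal_one, ← ENat.toENNReal_add]
        exact ENat.toENNReal_le.2 hcard
      have hpiece := h.lintegral_piece_le hφ hU hr hρ hS hg hM hc hcτ hC hGC hN hδ hδτ
        (n := n) (min_le_left (T (n + 1) ω) H) (min_le_right _ _)
      rw [← Ioc_union_Ioc_eq_Ioc h0 h2,
        lintegral_union measurableSet_Ioc (Ioc_disjoint_Ioc_of_le le_rfl)]
      calc _ ≤ ENNReal.ofReal ((N + 1) * C / c) * (jumpTimes T 0 H ω ∩ Iio (T n ω)).encard +
            ENNReal.ofReal ((N + 1) * C / c) := add_le_add ih hpiece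
        _ = ENNReal.ofReal ((N + 1) * C / c) *
            ((jumpTimes T 0 H ω ∩ Iio (T n ω)).encard + 1) := by rw [mul_add, mul_one]
        _ ≤ _ := by gcongr
  obtain ⟨n, hn⟩ := (h.tendsto.eventually_ge_atTop H).exists
  have hlast := key n
  rw [min_eq_right hn] at hlast
  refine hlast.trans ?_
  gcongr
  exact inter_subset_left

end Domination

/-! ### Cutting off near a compact level set -/

theorem levelKernel_add {δ v k l : ℝ} (hδ : 0 < δ) (hk : 0 ≤ k) (hl : 0 ≤ l) :
    levelKernel δ v (k + l) = levelKernel δ v k + levelKernel δ v l := by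
  unfold levelKernel
  split_ifs
  · rw [mul_add, ENNReal.ofReal_add (by positivity) (by positivity)]
  · simp

theorem levelKernel_sum {ι : Type*} {δ v : ℝ} (hδ : 0 < δ) (s : Finset ι) {k : ι → ℝ}
    (hk : ∀ i ∈ s, 0 ≤ k i) :
    levelKernel δ v (∑ i ∈ s, k i) = ∑ i ∈ s, levelKernel δ v (k i) := by
  classical
  induction s using Finset.induction_on with
  | empty => simp
  | insert i s hi ih =>
    rw [Finset.sum_insert hi, Finset.sum_insert hi, levelKernel_add hδ
      (hk i (Finset.mem_insert_self _ _))
      (Finset.sum_nonneg fun j hj => hk j (Finset.mem_insert_of_mem hj)),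
      ih fun j hj => hk j (Finset.mem_insert_of_mem hj)]

theorem levelKernel_mul_ofReal {δ v k q : ℝ} (hq : 0 ≤ q) :
    levelKernel δ v k * ENNReal.ofReal q = levelKernel δ v (k * q) := by
  unfold levelKernel
  rw [← ENNReal.ofReal_mul' hq]
  congr 1
  split_ifs <;> ring

open Measure in
/-- Around a compact piece `S` of a regular level set there is a cutoff function for which the layer
integrals converge to the surface integral over `S`, up to a factor `c`. It is the sum of the members
of a partition of unity that belong to balls in which the level set is almost flat. -/
theorem exists_cutoff_tendsto_lintegral_levelKernel {E : Type*} [NormedAddCommGroup E]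
    [InnerProductSpace ℝ E] [FiniteDimensional ℝ E] [MeasurableSpace E] [BorelSpace E]
    {ρ : E → ℝ} {n : ℕ} (hn : Module.finrank ℝ E = n + 1) (hρ : ContDiff ℝ 1 ρ) {S W : Set E}
    (hS : IsCompact S) (hW : IsOpen W) (hSW : S = W ∩ ρ ⁻¹' {0}) (hgrad : ∀ x ∈ S, ∇ ρ x ≠ 0)
    {c : ℝ} (hc : 1 < c) :
    μHE[n] S < ∞ ∧ ∃ f : E → ℝ, Continuous f ∧ (∀ x, 0 ≤ f x) ∧ HasCompactSupport f ∧
      tsupport f ⊆ W ∧ (∀ x ∈ S, f x = 1) ∧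
      ∀ q : E → ℝ, ContinuousOn q W → (∀ x ∈ W, 0 ≤ q x) →
        ∃ L, Tendsto (fun δ => ∫⁻ x, levelKernel δ (ρ x) (f x * q x)) (𝓝[>] 0) (𝓝 L) ∧
          L ≤ ENNReal.ofReal c * ∫⁻ x in S, ENNReal.ofReal (q x / ‖∇ ρ x‖) ∂μHE[n] ∧
          ∫⁻ x in S, ENNReal.ofReal (q x / ‖∇ ρ x‖) ∂μHE[n] ≤ ENNReal.ofReal c * L := by
  classical
  have hSsub : S ⊆ W := hSW ▸ inter_subset_left
  choose! R hR hRW hRfin hRlim using fun x (hx : x ∈ S) =>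
    exists_ball_tendsto_lintegral_levelKernel hn hρ (hgrad x hx) (hW.mem_nhds (hSsub hx)) hc
  obtain ⟨t, htS, ht⟩ := hS.elim_nhds_subcover (fun x => Metric.ball x (R x))
    fun x hx => Metric.ball_mem_nhds x (hR x hx)
  have hpiece : ∀ x ∈ t, Metric.ball x (R x) ∩ ρ ⁻¹' {0} = S ∩ Metric.ball x (R x) := by
    intro x hx
    rw [hSW]
    ext y
    have := @hRW x (htS x hx) y
    simp only [mem_inter_iff] at *
    tauto
  have hSm : MeasurableSet S := hS.measurableSet
  refine ⟨?_, ?_⟩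
  · have hsub : S ⊆ ⋃ x ∈ t, (Metric.ball x (R x) ∩ ρ ⁻¹' {0}) := by
      intro y hy
      obtain ⟨x, hx, hyx⟩ := mem_iUnion₂.1 (ht hy)
      refine mem_iUnion₂.2 ⟨x, hx, ?_⟩
      rw [hpiece x hx]
      exact ⟨hy, hyx⟩
    refine (measure_mono hsub).trans_lt ((measure_biUnion_finset_le _ _).trans_lt ?_)
    exact ENNReal.sum_lt_top.2 fun x hx => hRfin x (htS x hx)
  obtain ⟨F, hF⟩ := PartitionOfUnity.exists_isSubordinate hS.isClosed
    (fun x : t => Metric.ball (x : E) (R x)) (fun _ => Metric.isOpen_ball)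
    (fun y hy => by simpa using ht hy)
  have hFW : ∀ x : t, tsupport (F x) ⊆ W := fun x => (hF x).trans (hRW x (htS x x.2))
  have htsum : tsupport (fun y => ∑ x, F x y) ⊆ ⋃ x, tsupport (F x) := by
    refine closure_minimal (fun y hy => ?_) (isClosed_iUnion_of_finite fun x => isClosed_tsupport _)
    obtain ⟨x, -, hx⟩ := Finset.exists_ne_zero_of_sum_ne_zero hy
    exact mem_iUnion.2 ⟨x, subset_tsupport _ hx⟩
  have hFone : ∀ y ∈ S, ∑ x, F x y = 1 := fun y hy => by
    rw [← finsum_eq_sum_of_fintype]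
    exact F.sum_eq_one hy
  refine ⟨fun y => ∑ x, F x y, by fun_prop, fun y => Finset.sum_nonneg fun x _ => F.nonneg x y, ?_,
    htsum.trans (iUnion_subset hFW), hFone, fun q hq hq0 => ?_⟩
  · refine Metric.isCompact_of_isClosed_isBounded (isClosed_tsupport _)
      (Bornology.IsBounded.subset ?_ htsum)
    exact (Bornology.isBounded_iUnion).2 fun x => Metric.isBounded_ball.subset (hF x)
  have hts : ∀ x : t, tsupport (fun y => F x y * q y) ⊆ Metric.ball (x : E) (R x) := fun x =>
    (tsupport_mul_subset_left (f := F x) (g := q)).trans (hF x)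
  have hcont : ∀ x : t, Continuous fun y => F x y * q y := by
    intro x
    refine continuous_of_tsupport fun y hy => ?_
    have hyW : y ∈ W := hFW x (tsupport_mul_subset_left (f := F x) (g := q) hy)
    exact (F x).continuous.continuousAt.mul (hq.continuousAt (hW.mem_nhds hyW))
  have hnn : ∀ (x : t) y, 0 ≤ F x y * q y := by
    intro x y
    by_cases hy : y ∈ W
    · exact mul_nonneg (F.nonneg x y) (hq0 y hy)
    · rw [image_eq_zero_of_notMem_tsupport fun h => hy (hFW x h), zero_mul]
  choose L hL hL1 hL2 using fun x : t => hRlim x (htS x x.2) _ (hcont x) (hnn x) (hts x)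
  have hI : ∀ x : t, ∫⁻ y in Metric.ball (x : E) (R x) ∩ ρ ⁻¹' {0},
      ENNReal.ofReal (F x y * q y / ‖∇ ρ y‖) ∂μHE[n] =
      ∫⁻ y in S, ENNReal.ofReal (F x y * q y / ‖∇ ρ y‖) ∂μHE[n] := by
    intro x
    rw [hpiece x x.2, ← lintegral_indicator (hSm.inter measurableSet_ball),
      ← lintegral_indicator hSm]
    refine lintegral_congr fun y => ?_
    by_cases hyS : y ∈ S
    · by_cases hyb : y ∈ Metric.ball (x : E) (R x)
      · rw [indicator_of_mem (mem_inter hyS hyb), indicator_of_mem hyS]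
      · rw [indicator_of_notMem fun h => hyb h.2, indicator_of_mem hyS,
          image_eq_zero_of_notMem_tsupport (f := fun y => F x y * q y) fun h => hyb (hts x h)]
        simp
    · rw [indicator_of_notMem fun h => hyS h.1, indicator_of_notMem hyS]
  have hIsum : ∫⁻ y in S, ENNReal.ofReal (q y / ‖∇ ρ y‖) ∂μHE[n] =
      ∑ x : t, ∫⁻ y in S, ENNReal.ofReal (F x y * q y / ‖∇ ρ y‖) ∂μHE[n] := by
    have hmeas : ∀ x : t, Measurable fun y => ENNReal.ofReal (F x y * q y / ‖∇ ρ y‖) := fun x =>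
      ENNReal.measurable_ofReal.comp ((hcont x).measurable.div
        ((InnerProductSpace.toDual ℝ E).symm.continuous.comp
          (hρ.continuous_fderiv one_ne_zero)).norm.measurable)
    rw [← lintegral_finsetSum _ fun x _ => hmeas x]
    refine setLIntegral_congr_fun hSm fun y hy => ?_
    rw [← ENNReal.ofReal_sum_of_nonneg fun x _ => div_nonneg (hnn x y) (norm_nonneg _),
      ← Finset.sum_div, ← Finset.sum_mul, hFone y hy, one_mul]
  refine ⟨∑ x, L x, ?_, ?_, ?_⟩
  · refine (tendsto_finsetSum _ fun x _ => hL x).congr' ?_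
    filter_upwards [self_mem_nhdsWithin] with δ hδ
    rw [← lintegral_finsetSum _ fun x _ =>
      measurable_levelKernel hρ.continuous.measurable (hcont x).measurable δ]
    refine lintegral_congr fun y => ?_
    rw [Finset.sum_mul, levelKernel_sum hδ _ fun x _ => hnn x y]
  · rw [hIsum, Finset.mul_sum]
    exact Finset.sum_le_sum fun x _ => hI x ▸ hL1 x
  · rw [hIsum, Finset.mul_sum]
    exact Finset.sum_le_sum fun x _ => hI x ▸ hL2 x

/-! ### Expectations -/

section Expectation

variable {d : ℕ} {Ω : Type*} [MeasurableSpace Ω] {P : Measure Ω}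
  {U : Set (EuclideanSpace ℝ (Fin d))}
  {r : EuclideanSpace ℝ (Fin d) → EuclideanSpace ℝ (Fin d)}
  {φ : EuclideanSpace ℝ (Fin d) → ℝ → EuclideanSpace ℝ (Fin d)}
  {T : ℕ → Ω → ℝ} {M : ℕ → Ω → EuclideanSpace ℝ (Fin d)}
  {p : ℝ → EuclideanSpace ℝ (Fin d) → ℝ} {H : ℝ}

/-- The process has a version that is jointly measurable in time and chance. -/
theorem exists_measurable_version_psp (hU : IsOpen U) (hr : ContDiffOn ℝ 1 r U)
    (hφ : IsGlobalFlow U r φ) (hTM : IsMarkedPointProcess P U T M) :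
    ∃ X : ℝ × Ω → EuclideanSpace ℝ (Fin d), Measurable X ∧
      ∀ᵐ ω ∂P, ∀ s, 0 ≤ s → X (s, ω) = psp φ T M s ω := by
  classical
  obtain ⟨Ω₀, hΩ₀, hΩ₀m, hgood⟩ := (hTM.ae_isGoodPath).exists_measurable_mem
  set A : Set (ℝ × Ω) := Ici 0 ×ˢ Ω₀ with hA
  have hAm : MeasurableSet A := measurableSet_Ici.prod hΩ₀m
  -- the number of the piece is measurable off a null set, and there are countably many pieces
  set L : ℝ × Ω → ℕ := fun z => if z ∈ A then lastJump T z.1 z.2 else 0 with hL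
  have hLm : Measurable L := by
    refine measurable_to_countable' fun n => ?_
    have hpre : L ⁻¹' {n} = (A ∩ {z | T n z.2 ≤ z.1 ∧ z.1 < T (n + 1) z.2}) ∪
        (Aᶜ ∩ {_z | n = 0}) := by
      ext z
      by_cases hz : z ∈ A
      · have h := hgood z.2 hz.2
        obtain ⟨m, hm1, hm2⟩ := h.exists_le_lt hz.1
        simp only [mem_preimage, mem_singleton_iff, hL, hz, if_true, mem_union, mem_inter_iff,
          true_and, mem_compl_iff, not_true_eq_false, false_and, or_false, mem_ofPred_eq]
        refine ⟨fun he => ?_, fun he => h.lastJump_eq he.1 he.2⟩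
        rw [h.lastJump_eq hm1 hm2] at he
        exact he ▸ ⟨hm1, hm2⟩
      · simp [hL, hz, eq_comm]
    rw [hpre]
    refine (hAm.inter ?_).union (hAm.compl.inter (MeasurableSet.const _))
    exact (measurableSet_le ((hTM.measurable_time n).comp measurable_snd) measurable_fst).inter
      (measurableSet_lt measurable_fst ((hTM.measurable_time (n + 1)).comp measurable_snd))
  -- nothing is known about `φ` outside `U`
  have hΦ : Measurable ((U ×ˢ univ).indicator (Function.uncurry φ)) := by
    have h1 := (hφ.continuousOn hU hr).measurable_piecewise
      (continuousOn_const (c := (0 : EuclideanSpace ℝ (Fin d))))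
      ((hU.prod isOpen_univ).measurableSet)
    rw [← piecewise_eq_indicator]
    exact h1
  have hX : Measurable fun z : ℕ × ℝ × Ω =>
      (U ×ˢ univ).indicator (Function.uncurry φ) (M z.1 z.2.2, z.2.1 - T z.1 z.2.2) := by
    refine measurable_from_prod_countable_right fun n => hΦ.comp ?_
    exact ((hTM.measurable_mark n).comp measurable_snd).prodMk
      (measurable_fst.sub ((hTM.measurable_time n).comp measurable_snd))
  refine ⟨_, hX.comp (hLm.prodMk measurable_id), ?_⟩
  filter_upwards [hΩ₀] with ω hω s hs
  have hz : (s, ω) ∈ A := ⟨hs, hω⟩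
  simp only [Function.comp, id, hL, hz, if_true, psp]
  rw [indicator_of_mem (mk_mem_prod (hTM.mark_mem _ _) (mem_univ _))]
  rfl

/-- The expected occupation integral of the process in terms of its densities. -/
theorem lintegral_lintegral_psp [SFinite P] (hU : IsOpen U) (hr : ContDiffOn ℝ 1 r U)
    (hφ : IsGlobalFlow U r φ) (hTM : IsMarkedPointProcess P U T M)
    (hp : ∀ t, 0 ≤ t → IsDensityOf P (psp φ T M t) (p t))
    {F : EuclideanSpace ℝ (Fin d) → ℝ≥0∞} (hF : Measurable F) :
    AEMeasurable (fun ω => ∫⁻ s in Ioc 0 H, F (psp φ T M s ω)) P ∧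
      ∫⁻ ω, (∫⁻ s in Ioc 0 H, F (psp φ T M s ω)) ∂P =
        ∫⁻ s in Ioc 0 H, ∫⁻ x, F x * ENNReal.ofReal (p s x) := by
  obtain ⟨X, hXm, hX⟩ := exists_measurable_version_psp hU hr hφ hTM
  have hFX : Measurable fun z => F (X z) := hF.comp hXm
  have hae : (fun ω => ∫⁻ s in Ioc 0 H, F (X (s, ω))) =ᵐ[P]
      fun ω => ∫⁻ s in Ioc 0 H, F (psp φ T M s ω) := by
    filter_upwards [hX] with ω hω
    refine setLIntegral_congr_fun measurableSet_Ioc fun s hs => ?_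
    rw [hω s hs.1.le]
  refine ⟨⟨_, Measurable.lintegral_prod_left' hFX, hae.symm⟩, ?_⟩
  rw [← lintegral_congr_ae hae]
  calc ∫⁻ ω, (∫⁻ s in Ioc 0 H, F (X (s, ω))) ∂P
      = ∫⁻ s in Ioc 0 H, ∫⁻ ω, F (X (s, ω)) ∂P :=
        lintegral_lintegral_swap (f := fun ω s => F (X (s, ω)))
          ((hFX.comp measurable_swap).aemeasurable)
    _ = _ := by
        refine setLIntegral_congr_fun measurableSet_Ioc fun s hs => ?_
        have hs0 : 0 ≤ s := hs.1.le
        have hXs : Measurable fun ω => X (s, ω) := hXm.comp measurable_prodMk_left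
        have hmap : P.map (fun ω => X (s, ω)) =
            volume.withDensity fun x => ENNReal.ofReal (p s x) := by
          rw [← (hp s hs0).map_eq]
          refine Measure.map_congr ?_
          filter_upwards [hX] with ω hω using hω s hs0
        rw [← lintegral_map hF hXs, hmap, lintegral_withDensity_eq_lintegral_mul _
          ((hp s hs0).measurable.ennreal_ofReal) hF]
        refine lintegral_congr fun x => ?_
        rw [Pi.mul_apply, mul_comm]

/-- At a fixed time the process avoids a Lebesgue null set. The random variable is replaced by the
measurable version, as the path is not assumed measurable in chance. -/
theorem ae_psp_notMem (hU : IsOpen U) (hr : ContDiffOn ℝ 1 r U)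
    (hφ : IsGlobalFlow U r φ) (hTM : IsMarkedPointProcess P U T M)
    (hp : ∀ t, 0 ≤ t → IsDensityOf P (psp φ T M t) (p t)) {S : Set (EuclideanSpace ℝ (Fin d))}
    (hS : MeasurableSet S) (hS0 : volume S = 0) {t : ℝ} (ht : 0 ≤ t) :
    ∀ᵐ ω ∂P, psp φ T M t ω ∉ S := by
  obtain ⟨X, hXm, hX⟩ := exists_measurable_version_psp hU hr hφ hTM
  have hXt : Measurable fun ω => X (t, ω) := hXm.comp measurable_prodMk_left
  have hmap : P.map (fun ω => X (t, ω)) = volume.withDensity fun x => ENNReal.ofReal (p t x) := by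
    rw [← (hp t ht).map_eq]
    refine Measure.map_congr ?_
    filter_upwards [hX] with ω hω using hω t ht
  have h0 : P.map (fun ω => X (t, ω)) S = 0 := by
    rw [hmap]
    exact withDensity_absolutelyContinuous _ _ hS0
  rw [Measure.map_apply hXt hS] at h0
  filter_upwards [hX, measure_eq_zero_iff_ae_notMem.1 h0] with ω hω hω'
  rwa [← hω t ht]

theorem continuousOn_intervalIntegral_density {W : Set (EuclideanSpace ℝ (Fin d))} (hW : IsOpen W)
    (hH : 0 ≤ H) (hcont : ContinuousOn
      (fun z : EuclideanSpace ℝ (Fin d) × ℝ => p z.2 z.1) (W ×ˢ Icc 0 H)) :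
    ContinuousOn (fun x => ∫ s in (0 : ℝ)..H, p s x) W := by
  intro x₀ hx₀
  obtain ⟨R, hR, hball⟩ := Metric.nhds_basis_closedBall.mem_iff.1 (hW.mem_nhds hx₀)
  have hsub : Metric.closedBall x₀ R ×ˢ Icc 0 H ⊆ W ×ˢ Icc 0 H := prod_mono hball subset_rfl
  obtain ⟨C, hC⟩ := ((isCompact_closedBall x₀ R).prod isCompact_Icc).exists_bound_of_continuousOn
    (hcont.mono hsub)
  have hx : ∀ x ∈ W, ContinuousOn (fun s => p s x) (Icc 0 H) := fun x hx =>
    hcont.comp (f := fun s : ℝ => (x, s)) (by fun_prop) fun s hs => ⟨hx, hs⟩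
  refine ContinuousAt.continuousWithinAt
    (intervalIntegral.continuousAt_of_dominated_interval (bound := fun _ => C) ?_ ?_
      intervalIntegrable_const ?_)
  · filter_upwards [hW.mem_nhds hx₀] with x hxW
    rw [uIoc_of_le hH]
    exact ((hx x hxW).mono Ioc_subset_Icc_self).aestronglyMeasurable measurableSet_Ioc
  · filter_upwards [Metric.closedBall_mem_nhds x₀ hR] with x hxb
    refine Eventually.of_forall fun s hs => ?_
    rw [uIoc_of_le hH] at hs
    exact hC (x, s) ⟨hxb, Ioc_subset_Icc_self hs⟩
  · refine Eventually.of_forall fun s hs => ?_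
    rw [uIoc_of_le hH] at hs
    have h1 : ContinuousOn (fun x => p s x) W :=
      hcont.comp (f := fun x => (x, s)) (by fun_prop) fun x hx => ⟨hx, Ioc_subset_Icc_self hs⟩
    exact h1.continuousAt (hW.mem_nhds hx₀)

/-- For a function supported where the densities are jointly continuous, time integration and
space integration can be exchanged. -/
theorem lintegral_lintegral_density {W K : Set (EuclideanSpace ℝ (Fin d))} (hH : 0 ≤ H)
    (hp0 : ∀ t, 0 ≤ t → ∀ x, 0 ≤ p t x) (hcont : ContinuousOn
      (fun z : EuclideanSpace ℝ (Fin d) × ℝ => p z.2 z.1) (W ×ˢ Icc 0 H))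
    (hK : IsClosed K) (hKW : K ⊆ W) {F : EuclideanSpace ℝ (Fin d) → ℝ≥0∞} (hF : Measurable F)
    (hFK : ∀ x, x ∉ K → F x = 0) :
    ∫⁻ s in Ioc 0 H, ∫⁻ x, F x * ENNReal.ofReal (p s x) =
      ∫⁻ x, F x * ENNReal.ofReal (∫ s in (0 : ℝ)..H, p s x) := by
  classical
  set Ψ : EuclideanSpace ℝ (Fin d) × ℝ → ℝ := (K ×ˢ Icc 0 H).indicator fun z => p z.2 z.1 with hΨ
  have hΨm : Measurable Ψ := by
    have h1 := (hcont.mono (prod_mono hKW subset_rfl)).measurable_piecewise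
      (continuousOn_const (c := (0 : ℝ))) ((hK.prod isClosed_Icc).measurableSet)
    rw [hΨ, ← piecewise_eq_indicator]
    exact h1
  have heq : ∀ s ∈ Ioc 0 H, ∀ x,
      F x * ENNReal.ofReal (p s x) = F x * ENNReal.ofReal (Ψ (x, s)) := by
    intro s hs x
    by_cases hx : x ∈ K
    · rw [hΨ, indicator_of_mem (show (x, s) ∈ K ×ˢ Icc 0 H from ⟨hx, Ioc_subset_Icc_self hs⟩)]
    · simp [hFK x hx]
  calc ∫⁻ s in Ioc 0 H, ∫⁻ x, F x * ENNReal.ofReal (p s x)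
      = ∫⁻ s in Ioc 0 H, ∫⁻ x, F x * ENNReal.ofReal (Ψ (x, s)) :=
        setLIntegral_congr_fun measurableSet_Ioc fun s hs => lintegral_congr (heq s hs)
    _ = ∫⁻ x, ∫⁻ s in Ioc 0 H, F x * ENNReal.ofReal (Ψ (x, s)) := by
        refine lintegral_lintegral_swap (f := fun s x => F x * ENNReal.ofReal (Ψ (x, s)))
          (Measurable.aemeasurable ?_)
        exact (hF.comp measurable_snd).mul ((hΨm.comp measurable_swap).ennreal_ofReal)
    _ = _ := by
        refine lintegral_congr fun x => ?_
        by_cases hx : x ∈ K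
        · have hpx : ContinuousOn (fun s => p s x) (Icc 0 H) :=
            hcont.comp (f := fun s : ℝ => (x, s)) (by fun_prop) fun s hs => ⟨hKW hx, hs⟩
          have hint : IntegrableOn (fun s => p s x) (Ioc 0 H) :=
            (hpx.integrableOn_Icc).mono_set Ioc_subset_Icc_self
          rw [intervalIntegral.integral_of_le hH, ofReal_integral_eq_lintegral_ofReal hint,
            ← lintegral_const_mul'']
          · refine setLIntegral_congr_fun measurableSet_Ioc fun s hs => ?_
            exact (heq s hs x).symm
          · exact hint.aestronglyMeasurable.aemeasurable.ennreal_ofReal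
          · filter_upwards [ae_restrict_mem measurableSet_Ioc] with s hs
            exact hp0 s hs.1.le x
        · simp [hFK x hx]

end Expectation

/-! ### The Kac-Rice formula -/

theorem le_of_forall_le_ofReal_mul {a b : ℝ≥0∞}
    (h : ∀ c : ℝ, 1 < c → a ≤ ENNReal.ofReal c * b) : a ≤ b := by
  have h1 : Tendsto (fun c : ℝ => ENNReal.ofReal c * b) (𝓝[>] 1) (𝓝 (ENNReal.ofReal 1 * b)) :=
    ENNReal.Tendsto.mul_const
      ((ENNReal.continuous_ofReal.tendsto 1).mono_left nhdsWithin_le_nhds) (Or.inl (by simp))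
  rw [ENNReal.ofReal_one, one_mul] at h1
  refine ge_of_tendsto h1 ?_
  filter_upwards [self_mem_nhdsWithin] with c hc using h c hc

theorem inner_unitNormal {d : ℕ} (ρ : EuclideanSpace ℝ (Fin d) → ℝ)
    (r : EuclideanSpace ℝ (Fin d) → EuclideanSpace ℝ (Fin d)) (x : EuclideanSpace ℝ (Fin d)) :
    inner ℝ (r x) (unitNormal ρ x) = normalSpeed ρ r x / ‖∇ ρ x‖ := by
  rw [unitNormal, inner_smul_right, normalSpeed, real_inner_comm, div_eq_inv_mul]

end KacRice

theorem mainTheorem1 {d : ℕ} (hd : 2 ≤ d)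
    {Ω : Type*} [MeasurableSpace Ω] (P : Measure Ω) [IsProbabilityMeasure P]
    -- the state space, the vector field and its flow
    (U : Set (EuclideanSpace ℝ (Fin d))) (hU : IsOpen U) (hUconn : IsConnected U)
    (r : EuclideanSpace ℝ (Fin d) → EuclideanSpace ℝ (Fin d)) (hr : ContDiffOn ℝ 1 r U)
    (φ : EuclideanSpace ℝ (Fin d) → ℝ → EuclideanSpace ℝ (Fin d))
    (hφ : KacRice.IsGlobalFlow U r φ)
    -- the jump times and marks
    (T : ℕ → Ω → ℝ) (M : ℕ → Ω → EuclideanSpace ℝ (Fin d))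
    (hTM : KacRice.IsMarkedPointProcess P U T M)
    (hjumps : ∀ a b : ℝ, ∫⁻ ω, ((KacRice.jumpTimes T a b ω).encard : ℝ≥0∞) ∂P < ∞)
    -- the densities of the process
    (p : ℝ → EuclideanSpace ℝ (Fin d) → ℝ)
    (hp : ∀ t, 0 ≤ t → KacRice.IsDensityOf P (KacRice.psp φ T M t) (p t))
    -- the hypersurface
    (D S : Set (EuclideanSpace ℝ (Fin d))) (ρ : EuclideanSpace ℝ (Fin d) → ℝ)
    (hDopen : IsOpen D) (hDconn : IsConnected D) (hDbdd : Bornology.IsBounded D)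
    (hρ : KacRice.IsDefiningFunction U D ρ)
    (hS : S = U ∩ frontier D) (hScomp : IsCompact S)
    -- the time horizon
    (H : ℝ) (hH : 0 ≤ H)
    -- the flow is not tangent to `S`, and its numbers of crossings are uniformly bounded
    (htransverse : ∀ x ∈ S, inner ℝ (r x) (KacRice.unitNormal ρ x) ≠ 0)
    (hbound : (⨆ x ∈ U, KacRice.crossingCount S (φ x) H) < ⊤)
    -- the process does not jump from or to `S`
    (hnojump : ∀ᵐ ω ∂P, KacRice.NoJumpFromOrTo S (fun t => KacRice.psp φ T M t ω) H)
    -- the densities are jointly continuous near `S`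
    (hcont : ∃ V ∈ 𝓝ˢ S, ContinuousOn
      (fun z : EuclideanSpace ℝ (Fin d) × ℝ => p z.2 z.1) (V ×ˢ Icc 0 H)) :
    AEMeasurable
        (fun ω => (KacRice.crossingCount S (fun t => KacRice.psp φ T M t ω) H : ℝ≥0∞)) P ∧
      IntegrableOn
        (fun x => |inner ℝ (r x) (KacRice.unitNormal ρ x)| * ∫ s in (0 : ℝ)..H, p s x)
        S (μHE[d - 1] : Measure (EuclideanSpace ℝ (Fin d))) ∧
      ∫⁻ ω, (KacRice.crossingCount S (fun t => KacRice.psp φ T M t ω) H : ℝ≥0∞) ∂P =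
        ENNReal.ofReal (∫ x in S,
          |inner ℝ (r x) (KacRice.unitNormal ρ x)| * (∫ s in (0 : ℝ)..H, p s x)
            ∂(μHE[d - 1] : Measure (EuclideanSpace ℝ (Fin d)))) := by
  classical
  obtain ⟨V, hV, hVc⟩ := hcont
  have hρc := hρ.contDiff
  have hSiff : ∀ x, x ∈ S ↔ x ∈ U ∧ ρ x = 0 := fun x => by rw [hS, hρ.mem_iff hDopen]
  have hgrad : ∀ x ∈ S, ∇ ρ x ≠ 0 := fun x hx => hρ.gradient_ne_zero x (hS ▸ hx)
  have hg : ∀ x ∈ S, KacRice.normalSpeed ρ r x ≠ 0 := fun x hx h0 => by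
    refine htransverse x hx ?_
    rw [KacRice.inner_unitNormal, h0, zero_div]
  have hgc := KacRice.continuousOn_normalSpeed hρc hr
  have hn : Module.finrank ℝ (EuclideanSpace ℝ (Fin d)) = (d - 1) + 1 := by
    rw [finrank_euclideanSpace_fin]
    omega
  -- the neighbourhood of `S` where the flow is transverse and the densities are continuous
  set W : Set (EuclideanSpace ℝ (Fin d)) :=
    interior V ∩ (U ∩ KacRice.normalSpeed ρ r ⁻¹' {0}ᶜ) with hWdef
  have hW : IsOpen W :=
    isOpen_interior.inter (hgc.isOpen_inter_preimage hU isOpen_compl_singleton)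
  have hWU : W ⊆ U := fun x hx => hx.2.1
  have hSW : S = W ∩ ρ ⁻¹' {0} := by
    ext x
    refine ⟨fun hx => ⟨⟨subset_interior_iff_mem_nhdsSet.2 hV hx, ((hSiff x).1 hx).1, hg x hx⟩,
      ((hSiff x).1 hx).2⟩, fun hx => (hSiff x).2 ⟨hWU hx.1, hx.2⟩⟩
  have hSsub : S ⊆ W := hSW ▸ inter_subset_left
  have hSm : MeasurableSet S := hScomp.measurableSet
  have hpc : ContinuousOn (fun z : EuclideanSpace ℝ (Fin d) × ℝ => p z.2 z.1) (W ×ˢ Icc 0 H) :=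
    hVc.mono (prod_mono (inter_subset_left.trans interior_subset) subset_rfl)
  have hp0 : ∀ t, 0 ≤ t → ∀ x, 0 ≤ p t x := fun t ht x => (hp t ht).nonneg x
  have hQ0 : ∀ x, 0 ≤ ∫ s in (0 : ℝ)..H, p s x := fun x =>
    intervalIntegral.integral_nonneg hH fun s hs => hp0 s hs.1 x
  set q : EuclideanSpace ℝ (Fin d) → ℝ :=
    fun x => |KacRice.normalSpeed ρ r x| * ∫ s in (0 : ℝ)..H, p s x with hq
  have hqc : ContinuousOn q W :=
    (hgc.mono hWU).abs.mul (KacRice.continuousOn_intervalIntegral_density hW hH hpc)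
  have hq0 : ∀ x, 0 ≤ q x := fun x => mul_nonneg (abs_nonneg _) (hQ0 x)
  obtain ⟨N, hN⟩ : ∃ N : ℕ, ∀ x ∈ U, KacRice.crossingCount S (φ x) H ≤ N := by
    obtain ⟨N, hN⟩ := ENat.ne_top_iff_exists.1 hbound.ne
    exact ⟨N, fun x hx => hN ▸ le_iSup₂ (f := fun x (_ : x ∈ U) => KacRice.crossingCount S (φ x) H)
      x hx⟩
  have hσ : (μHE[d - 1] : Measure (EuclideanSpace ℝ (Fin d))) S < ∞ :=
    (KacRice.exists_cutoff_tendsto_lintegral_levelKernel hn hρc hScomp hW hSW hgrad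
      one_lt_two).1
  have hvol : (volume : Measure (EuclideanSpace ℝ (Fin d))) S = 0 := by
    -- finite `(d - 1)`-dimensional measure implies vanishing `d`-dimensional measure
    rw [← EuclideanSpace.euclideanHausdorffMeasure_eq_volume]
    exact (Measure.euclideanHausdorffMeasure_zero_or_top (by omega : d - 1 < d) S).resolve_right
      hσ.ne
  have hgood := hTM.ae_isGoodPath
  have hX0 := KacRice.ae_psp_notMem hU hr hφ hTM hp hSm hvol le_rfl
  have hXH := KacRice.ae_psp_notMem hU hr hφ hTM hp hSm hvol hH
  -- the formula up to a factor `c`; the measurability of the number of crossings comes along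
  have hkey : ∀ c : ℝ, 1 < c → AEMeasurable
      (fun ω => (KacRice.crossingCount S (fun t => KacRice.psp φ T M t ω) H : ℝ≥0∞)) P ∧
      (∫⁻ ω, (KacRice.crossingCount S (fun t => KacRice.psp φ T M t ω) H : ℝ≥0∞) ∂P ≤
        ENNReal.ofReal c * ∫⁻ x in S, ENNReal.ofReal (q x / ‖∇ ρ x‖) ∂μHE[d - 1]) ∧
      ∫⁻ x in S, ENNReal.ofReal (q x / ‖∇ ρ x‖) ∂μHE[d - 1] ≤ ENNReal.ofReal c *
        ∫⁻ ω, (KacRice.crossingCount S (fun t => KacRice.psp φ T M t ω) H : ℝ≥0∞) ∂P := by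
    intro c hc
    obtain ⟨-, f, hf, hf0, hfcomp, hfW, hfS, hflim⟩ :=
      KacRice.exists_cutoff_tendsto_lintegral_levelKernel hn hρc hScomp hW hSW hgrad hc
    obtain ⟨L, hL, hL1, hL2⟩ := hflim q hqc fun x _ => hq0 x
    set G : EuclideanSpace ℝ (Fin d) → ℝ := fun x => f x * |KacRice.normalSpeed ρ r x| with hG
    have hGt : tsupport G ⊆ tsupport f := tsupport_mul_subset_left
    have hGc : Continuous G := continuous_of_tsupport fun x hx =>
      hf.continuousAt.mul (hgc.continuousAt (hU.mem_nhds (hWU (hfW (hGt hx))))).abs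
    have hGS : ∀ x ∈ S, G x = |KacRice.normalSpeed ρ r x| := fun x hx => by
      rw [hG]
      simp only [hfS x hx, one_mul]
    obtain ⟨C, hC⟩ := hGc.bounded_above_of_compact_support
      (IsCompact.of_isClosed_subset hfcomp (isClosed_tsupport G) hGt)
    have hC0 : 0 ≤ C := (norm_nonneg _).trans (hC 0)
    obtain ⟨κ, hκ, τ, hτ, hκτ⟩ := hφ.exists_forall_le_normalSpeed hU hr hρc hfcomp
      (hfW.trans hWU) fun x hx => (hfW hx).2.2
    have hGκ : ∀ x ∈ U, G x ≠ 0 → ∀ s : ℝ, |s| < τ → κ ≤ |KacRice.normalSpeed ρ r (φ x s)| :=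
      fun x _ hx => hκτ x (hGt (subset_tsupport G hx))
    -- a sequence of levels for which the domination holds throughout
    set δ : ℕ → ℝ := fun k => κ * τ / (k + 2) with hδ
    have hδ0 : ∀ k, 0 < δ k := fun k => by positivity
    have hδτ : ∀ k, δ k < κ * τ := fun k => by
      refine div_lt_self (mul_pos hκ hτ) ?_
      have : (0 : ℝ) ≤ k := Nat.cast_nonneg k
      linarith
    have hδlim : Tendsto δ atTop (𝓝[>] 0) := by
      refine tendsto_nhdsWithin_iff.2 ⟨?_, Eventually.of_forall hδ0⟩
      exact tendsto_const_nhds.div_atTop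
        (tendsto_atTop_add_const_right _ _ tendsto_natCast_atTop_atTop)
    set A : ℕ → Ω → ℝ≥0∞ := fun k ω => ∫⁻ s in Ioc 0 H, KacRice.levelKernel (δ k)
      (ρ (KacRice.psp φ T M s ω)) (G (KacRice.psp φ T M s ω)) with hA
    have hFm : ∀ k, Measurable fun x => KacRice.levelKernel (δ k) (ρ x) (G x) := fun k =>
      KacRice.measurable_levelKernel hρc.continuous.measurable hGc.measurable _
    have hAm : ∀ k, AEMeasurable (A k) P := fun k =>
      (KacRice.lintegral_lintegral_psp hU hr hφ hTM hp (hFm k)).1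
    have hAlim : ∀ᵐ ω ∂P, Tendsto (fun k => A k ω) atTop
        (𝓝 (KacRice.crossingCount S (fun t => KacRice.psp φ T M t ω) H)) := by
      filter_upwards [hgood, hX0, hXH, hnojump] with ω hω h0 h1 h2
      exact (hω.tendsto_crossingCount hφ hρc hSiff hg (fun n => hTM.mark_mem n ω) hH h2 hGc hGS
        h0 h1).comp hδlim
    have hAbd : ∀ k, ∀ᵐ ω ∂P, A k ω ≤
        ENNReal.ofReal ((N + 1) * C / κ) * (KacRice.jumpTimes T 0 H ω).encard := by
      intro k
      filter_upwards [hgood] with ω hω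
      exact hω.lintegral_path_le hφ hU hr hρc hSiff hg (fun n => hTM.mark_mem n ω) hH hκ hGκ hC0
        (fun x => (le_abs_self _).trans (hC x)) hN (hδ0 k) (hδτ k)
    have hbdfin : ∫⁻ ω, ENNReal.ofReal ((N + 1) * C / κ) *
        (KacRice.jumpTimes T 0 H ω).encard ∂P ≠ ∞ := by
      rw [lintegral_const_mul' _ _ ENNReal.ofReal_ne_top]
      exact ENNReal.mul_ne_top ENNReal.ofReal_ne_top (hjumps 0 H).ne
    have hEA : ∀ k, ∫⁻ ω, A k ω ∂P = ∫⁻ x, KacRice.levelKernel (δ k) (ρ x) (f x * q x) := by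
      intro k
      rw [(KacRice.lintegral_lintegral_psp hU hr hφ hTM hp (hFm k)).2,
        KacRice.lintegral_lintegral_density hH hp0 hpc (isClosed_tsupport f) hfW (hFm k)
          fun x hx => by
            rw [image_eq_zero_of_notMem_tsupport fun h => hx (hGt h),
              KacRice.levelKernel_zero_right]]
      refine lintegral_congr fun x => ?_
      rw [KacRice.levelKernel_mul_ofReal (hQ0 x), hG, hq, mul_assoc]
    have hdom := tendsto_lintegral_of_dominated_convergence' _ hAm hAbd hbdfin hAlim
    simp_rw [hEA] at hdom
    rw [tendsto_nhds_unique hdom (hL.comp hδlim)]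
    exact ⟨aemeasurable_of_tendsto_metrizable_ae atTop hAm hAlim, hL1, hL2⟩
  have hE : ∫⁻ ω, (KacRice.crossingCount S (fun t => KacRice.psp φ T M t ω) H : ℝ≥0∞) ∂P =
      ∫⁻ x in S, ENNReal.ofReal (q x / ‖∇ ρ x‖) ∂μHE[d - 1] :=
    le_antisymm (KacRice.le_of_forall_le_ofReal_mul fun c hc => (hkey c hc).2.1)
      (KacRice.le_of_forall_le_ofReal_mul fun c hc => (hkey c hc).2.2)
  have hform : (fun x => |inner ℝ (r x) (KacRice.unitNormal ρ x)| * ∫ s in (0 : ℝ)..H, p s x) =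
      fun x => q x / ‖∇ ρ x‖ := by
    ext x
    rw [KacRice.inner_unitNormal, abs_div, abs_norm, hq, div_mul_eq_mul_div]
  have hfc : ContinuousOn (fun x => q x / ‖∇ ρ x‖) S :=
    (hqc.mono hSsub).div (KacRice.continuous_gradient hρc).norm.continuousOn
      fun x hx => norm_ne_zero_iff.2 (hgrad x hx)
  have hint : IntegrableOn (fun x => q x / ‖∇ ρ x‖) S
      (μHE[d - 1] : Measure (EuclideanSpace ℝ (Fin d))) := by
    obtain ⟨B, hB⟩ := hScomp.exists_bound_of_continuousOn hfc
    refine IntegrableOn.of_bound hσ (hfc.aestronglyMeasurable hSm) B ?_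
    filter_upwards [ae_restrict_mem hSm] with x hx using hB x hx
  rw [hform]
  refine ⟨(hkey 2 one_lt_two).1, hint, ?_⟩
  rw [hE, ofReal_integral_eq_lintegral_ofReal hint
    (Eventually.of_forall fun x => div_nonneg (hq0 x) (norm_nonneg _))]
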